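/- Let $n\ge 0$ be an integer, and let all indices below run through $\{1,\dots,n+1\}$. Let $D^h[a,b,c,d]$ be the homogenized Weyl algebra: the associative $\mathbb C$-algebra generated by the parameters $a_{pq}$ ($p\le q$), $b_i$, $c_i$, $d$, the space variables $x_{ij}$ ($i\le j$), $y_i$, $r$, the operators $\partial_{ij}$ ($i\le j$), $\partial_i$, $\partial_r$, and the homogenization variable $h$, with the relations $\partial_{ij}x_{ij}=x_{ij}\partial_{ij}+h^2$, $\partial_iy_i=y_i\partial_i+h^2$, $\partial_rr=r\partial_r+h^2$, all other pairs of generators commuting. Put $x_{ij}=x_{ji}$, $\partial_{ij}=\partial_{ji}$. Every element is uniquely a linear combination of normally ordered monomials (operators $\partial$ to the right), which are identified with the monomials of the associated commutative polynomial ring. Let $<$ be the order $<^h_{(-w,w,0)}$ on these monomials, which compares first the total degree (every generator having degree $1$), second the $(-w,w,0)$-degree (the weights are $-1$ for $x_{ij}$ and $1$ for $\partial_{ij}$ when $i\ne j$, and $0$ for all other generators), and finally the block order $$d\gg r\gg\{a_{pq}\}\gg\{b_i\}\gg\{c_i\}\gg\{y_i\}\gg\partial_r\gg\{\partial_{ij}\mid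 i<j\}\gg\{\partial_{ii}\}\gg\{\partial_i\}\gg\{x_{ij}\mid i<j\}\gg\{x_{ii}\}\gg h,$$ where the block $\{b_i\}$ is ordered lexicographically with $b_1>b_2>\cdots>b_{n+1}$ and every other block by an arbitrary fixed term order. Consider $$A'^h_{pq}=hx_{pq}\partial_{pq}-x_{pq}\partial_p\partial_q-a_{pq}^3\quad(p\le q),\qquad B=\sum_{i}\partial_i^2-r^2,$$ $$C'^h_{ij}=x_{ij}\partial_i^2+2(x_{jj}-x_{ii})\partial_i\partial_j-x_{ij}\partial_j^2+\sum_{s\ne i,j}(x_{sj}\partial_i\partial_s-x_{is}\partial_j\partial_s)+(hy_j+b_jc_j)\partial_i-(hy_i+b_ic_i)\partial_j\quad(i<j),$$ $$E'^h=hr\partial_r-2\sum_{i\le j}x_{ij}\partial_i\partial_j-\sum_i(hy_i+b_ic_i)\partial_i-nh^3-d^3,$$ and let $I'^h$ be the left ideal of $D^h[a,b,c,d]$ generated by the finite set $G'^h=\{A'^h_{pq}\ (p\le q),\ B,\ C'^h_{ij}\ (i<j),\ E'^h\}$. Then $G'^h$ is a Gröbner basis of $I'^h$ with respect to $<$; that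 is, $G'^h$ generates $I'^h$, and the ideal of the commutative polynomial ring generated by the initial monomials of all elements of $I'^h$ is generated by the initial monomials of the elements of $G'^h$. -/

import Mathlib

namespace FisherBingham

open MvPolynomial
open scoped MonomialOrder

/-- The variables of the homogenized Weyl algebra, `N = n + 1`: the commuting parameters
`a_{pq}`, `b_i`, `c_i`, `d`, the space variables `x_{ij}`, `y_i`, `r`, the differential operators
`∂_{ij}`, `∂_i`, `∂_r`, and the homogenization variable `h`. Symmetric double indices are
unordered pairs `s(i, j)`, so that `x_{ij} = x_{ji}` and `∂_{ij} = ∂_{ji}`. -/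
inductive Var (n : ℕ) : Type
  | a (p : Sym2 (Fin (n + 1)))
  | b (i : Fin (n + 1))
  | c (i : Fin (n + 1))
  | d
  | x (p : Sym2 (Fin (n + 1)))
  | y (i : Fin (n + 1))
  | r
  | dx (p : Sym2 (Fin (n + 1)))
  | dy (i : Fin (n + 1))
  | dr
  | h

namespace Var

variable {n : ℕ}

/-- The space variable with respect to which a variable differentiates, if it is one of the
differential operators. -/
def base : Var n → Option (Var n)
  | dx p => some (x p)
  | dy i => some (y i)
  | dr => some r
  | _ => none

/-- The weight vector `(-w, w, 0)`, with `w_{ij} = 1` for `i ≠ j` and `w_{ii} = w_k = w_r = 0`. -/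
def weight : Var n → ℤ
  | x p => if p.IsDiag then 0 else -1
  | dx p => if p.IsDiag then 0 else 1
  | _ => 0

instance : Finite (Var n) := by
  refine Finite.of_surjective
    (α := (Sym2 (Fin (n + 1)) × Fin 3) ⊕ (Fin (n + 1) × Fin 4) ⊕ Fin 4)
    (fun t => match t with
      | .inl (p, k) => ![a p, x p, dx p] k
      | .inr (.inl (i, k)) => ![b i, c i, y i, dy i] k
      | .inr (.inr k) => ![d, r, dr, h] k) ?_
  intro v
  cases v with
  | a p => exact ⟨.inl (p, 0), rfl⟩
  | x p => exact ⟨.inl (p, 1), rfl⟩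
  | dx p => exact ⟨.inl (p, 2), rfl⟩
  | b i => exact ⟨.inr (.inl (i, 0)), rfl⟩
  | c i => exact ⟨.inr (.inl (i, 1)), rfl⟩
  | y i => exact ⟨.inr (.inl (i, 2)), rfl⟩
  | dy i => exact ⟨.inr (.inl (i, 3)), rfl⟩
  | d => exact ⟨.inr (.inr 0), rfl⟩
  | r => exact ⟨.inr (.inr 1), rfl⟩
  | dr => exact ⟨.inr (.inr 2), rfl⟩
  | h => exact ⟨.inr (.inr 3), rfl⟩

lemma base_of_base {u v : Var n} (hb : base u = some v) : base v = none := by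
  cases u <;> simp_all [base] <;> subst hb <;> rfl

lemma base_h : base (h : Var n) = none := rfl

lemma base_ne_h (u : Var n) : base u ≠ some h := by
  cases u <;> simp [base]

end Var

/-! ### The homogenized Weyl algebra -/

/-- The defining relations: `∂ v = v ∂ + h ^ 2` if `∂` is the operator of the space variable `v`;
all other pairs of variables commute. -/
inductive HRel (n : ℕ) : FreeAlgebra ℂ (Var n) → FreeAlgebra ℂ (Var n) → Prop
  | comm (u v : Var n) (huv : u.base ≠ some v) (hvu : v.base ≠ some u) :
      HRel n (FreeAlgebra.ι ℂ u * FreeAlgebra.ι ℂ v) (FreeAlgebra.ι ℂ v * FreeAlgebra.ι ℂ u)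
  | weyl (u v : Var n) (huv : u.base = some v) :
      HRel n (FreeAlgebra.ι ℂ u * FreeAlgebra.ι ℂ v)
        (FreeAlgebra.ι ℂ v * FreeAlgebra.ι ℂ u + FreeAlgebra.ι ℂ Var.h ^ 2)

/-- The homogenized Weyl algebra `D^h[a, b, c, d]` over the complex numbers. -/
abbrev HWeyl (n : ℕ) : Type := RingQuot (HRel n)

/-- The generators of the homogenized Weyl algebra. -/
noncomputable def gen {n : ℕ} (v : Var n) : HWeyl n :=
  RingQuot.mkAlgHom ℂ (HRel n) (FreeAlgebra.ι ℂ v)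

/-! ### Normally ordered expressions -/

/-- Left multiplication by a variable in normally ordered coordinates, where the differential
operators are written to the right of all other variables: the operator of `v` acts
as `ξ_v + h ^ 2 ∂/∂v`, every other variable by multiplication. -/
noncomputable def leftMul {n : ℕ} (u : Var n) : Module.End ℂ (MvPolynomial (Var n) ℂ) :=
  LinearMap.mulLeft ℂ (X u) +
    match u.base with
    | none => 0
    | some v => LinearMap.mulLeft ℂ (X Var.h ^ 2) ∘ₗ (pderiv v).toLinearMap

lemma leftMul_of_none {n : ℕ} {u : Var n} (hu : u.base = none) (p : MvPolynomial (Var n) ℂ) :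
    leftMul u p = X u * p := by
  simp [leftMul, hu]

lemma leftMul_of_some {n : ℕ} {u v : Var n} (hu : u.base = some v)
    (p : MvPolynomial (Var n) ℂ) :
    leftMul u p = X u * p + X Var.h ^ 2 * pderiv v p := by
  simp [leftMul, hu]

lemma pderiv_X_h {n : ℕ} {u v : Var n} (hu : u.base = some v) :
    pderiv v (X Var.h : MvPolynomial (Var n) ℂ) = 0 :=
  pderiv_X_of_ne (fun e => Var.base_ne_h u (by rw [hu, e]))

lemma pderiv_comm {n : ℕ} (u v : Var n) (p : MvPolynomial (Var n) ℂ) :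
    pderiv u (pderiv v p) = pderiv v (pderiv u p) := by
  classical
  have hc : ⁅(pderiv u : Derivation ℂ (MvPolynomial (Var n) ℂ) (MvPolynomial (Var n) ℂ)),
      (pderiv v : Derivation ℂ (MvPolynomial (Var n) ℂ) (MvPolynomial (Var n) ℂ))⁆ = 0 := by
    apply MvPolynomial.derivation_ext
    intro i
    simp only [Derivation.commutator_apply, pderiv_X, Derivation.coe_zero, Pi.zero_apply]
    by_cases h1 : u = i <;> by_cases h2 : v = i <;> simp [h1, h2]
  have := DFunLike.congr_fun hc p
  simpa [Derivation.commutator_apply, sub_eq_zero] using this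

lemma leftMul_rel {n : ℕ} ⦃s t : FreeAlgebra ℂ (Var n)⦄ (hst : HRel n s t) :
    FreeAlgebra.lift ℂ leftMul s = FreeAlgebra.lift ℂ leftMul t := by
  induction hst with
  | comm u v huv hvu =>
    refine LinearMap.ext fun p => ?_
    simp only [map_mul, FreeAlgebra.lift_ι_apply, Module.End.mul_apply]
    rcases hu : u.base with _ | u' <;> rcases hv : v.base with _ | v'
    · simp only [leftMul_of_none hu, leftMul_of_none hv]; ring
    · have h1 : pderiv v' (X u : MvPolynomial (Var n) ℂ) = 0 :=
        pderiv_X_of_ne (fun e => hvu (by rw [hv, e]))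
      simp only [leftMul_of_none hu, leftMul_of_some hv, Derivation.leibniz, h1, smul_eq_mul]
      ring
    · have h1 : pderiv u' (X v : MvPolynomial (Var n) ℂ) = 0 :=
        pderiv_X_of_ne (fun e => huv (by rw [hu, e]))
      simp only [leftMul_of_some hu, leftMul_of_none hv, Derivation.leibniz, h1, smul_eq_mul]
      ring
    · have h1 : pderiv u' (X v : MvPolynomial (Var n) ℂ) = 0 :=
        pderiv_X_of_ne (fun e => huv (by rw [hu, e]))
      have h2 : pderiv v' (X u : MvPolynomial (Var n) ℂ) = 0 :=
        pderiv_X_of_ne (fun e => hvu (by rw [hv, e]))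
      simp only [leftMul_of_some hu, leftMul_of_some hv, Derivation.leibniz, map_add, h1, h2,
        smul_eq_mul, Derivation.leibniz_pow, pderiv_X_h hu, pderiv_X_h hv, pderiv_comm u' v']
      ring
  | weyl u v huv =>
    refine LinearMap.ext fun p => ?_
    have hv : v.base = none := Var.base_of_base huv
    simp only [map_mul, map_add, FreeAlgebra.lift_ι_apply, Module.End.mul_apply,
      LinearMap.add_apply, pow_two, leftMul_of_some huv, leftMul_of_none hv,
      leftMul_of_none Var.base_h, Derivation.leibniz, pderiv_X_self, smul_eq_mul]
    ring

/-- The left regular representation of the homogenized Weyl algebra in normally ordered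
coordinates. -/
noncomputable def regRep (n : ℕ) : HWeyl n →ₐ[ℂ] Module.End ℂ (MvPolynomial (Var n) ℂ) :=
  RingQuot.liftAlgHom ℂ ⟨FreeAlgebra.lift ℂ leftMul, leftMul_rel⟩

lemma regRep_gen {n : ℕ} (v : Var n) : regRep n (gen v) = leftMul v := by
  simp [regRep, gen]

/-- The normally ordered expression of an element of the homogenized Weyl algebra, as an element
of the associated commutative polynomial ring: a differential operator is written there as the
commuting variable of the same name. -/
noncomputable def normalForm (n : ℕ) : HWeyl n →ₗ[ℂ] MvPolynomial (Var n) ℂ :=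
  LinearMap.applyₗ 1 ∘ₗ (regRep n).toLinearMap

/-- The normally ordered monomial with a given exponent: the product of all parameters, space
variables and powers of `h`, followed by the product of all differential operators. -/
noncomputable def normalMonomial {n : ℕ} (α : Var n →₀ ℕ) : HWeyl n :=
  (((Finsupp.toMultiset α).filter (fun v => v.base.isNone)).toList.map gen).prod *
    (((Finsupp.toMultiset α).filter (fun v => ¬ v.base.isNone)).toList.map gen).prod

/-- The element of the homogenized Weyl algebra with a given normally ordered expression. -/
noncomputable def ofNormalForm (n : ℕ) : MvPolynomial (Var n) ℂ →ₗ[ℂ] HWeyl n :=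
  (basisMonomials (Var n) ℂ).constr ℂ normalMonomial

lemma normalForm_gen_mul {n : ℕ} (v : Var n) (f : HWeyl n) :
    normalForm n (gen v * f) = leftMul v (normalForm n f) := by
  simp [normalForm, regRep_gen]

lemma normalForm_one (n : ℕ) : normalForm n 1 = 1 := by
  simp [normalForm]

lemma normalForm_words {n : ℕ} (l₁ l₂ : List (Var n)) (h₁ : ∀ v ∈ l₁, v.base.isNone)
    (h₂ : ∀ v ∈ l₂, ¬ v.base.isNone) :
    normalForm n ((l₁.map gen).prod * (l₂.map gen).prod) =
      (l₁.map X).prod * (l₂.map X).prod := by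
  induction l₁ with
  | nil =>
    induction l₂ with
    | nil => simp [normalForm_one]
    | cons v l ih =>
      have ih' := ih (fun w hw => h₂ w (List.mem_cons_of_mem _ hw))
      obtain ⟨u, hu⟩ : ∃ u, v.base = some u := by
        have := h₂ v (by simp)
        rcases hv : v.base with _ | u
        · simp [hv] at this
        · exact ⟨u, rfl⟩
      have hd : ∀ l' : List (Var n), (∀ w ∈ l', ¬ w.base.isNone) →
          pderiv u ((l'.map X).prod : MvPolynomial (Var n) ℂ) = 0 := by
        intro l' hl'
        induction l' with
        | nil => simp
        | cons w l' ih2 =>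
          have hw : w ≠ u := by
            rintro rfl
            exact hl' w (by simp) (by rw [Var.base_of_base hu]; rfl)
          rw [List.map_cons, List.prod_cons, Derivation.leibniz, pderiv_X_of_ne hw,
            ih2 (fun z hz => hl' z (List.mem_cons_of_mem _ hz))]
          simp
      simp only [List.map_nil, List.prod_nil, one_mul] at ih' ⊢
      simp only [List.map_cons, List.prod_cons, normalForm_gen_mul]
      rw [ih', leftMul_of_some hu, hd l (fun w hw => h₂ w (List.mem_cons_of_mem _ hw))]
      simp
  | cons v l ih =>
    have ih' := ih (fun w hw => h₁ w (List.mem_cons_of_mem _ hw))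
    have hv : v.base = none := by simpa using h₁ v (by simp)
    simp only [List.map_cons, List.prod_cons, mul_assoc, normalForm_gen_mul]
    rw [ih', leftMul_of_none hv]

lemma prod_map_X {n : ℕ} (α : Var n →₀ ℕ) :
    ((Finsupp.toMultiset α).map (X : Var n → MvPolynomial (Var n) ℂ)).prod =
      monomial α 1 := by
  induction α using Finsupp.induction_linear with
  | zero => simp
  | add α β hα hβ => rw [map_add, Multiset.map_add, Multiset.prod_add, hα, hβ, monomial_mul,
      one_mul]
  | single v k =>
    rw [Finsupp.toMultiset_single, Multiset.map_nsmul, Multiset.prod_nsmul, Multiset.map_singleton,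
      Multiset.prod_singleton, X_pow_eq_monomial]

/-- The normally ordered expression of a normally ordered monomial. -/
theorem normalForm_normalMonomial {n : ℕ} (α : Var n →₀ ℕ) :
    normalForm n (normalMonomial α) = monomial α 1 := by
  rw [normalMonomial, normalForm_words, ← prod_map_X, ← Multiset.prod_coe, ← Multiset.prod_coe,
    ← Multiset.map_coe, ← Multiset.map_coe, Multiset.coe_toList, Multiset.coe_toList,
    ← Multiset.prod_add, ← Multiset.map_add, Multiset.filter_add_not]
  · intro v hv
    rw [Multiset.mem_toList, Multiset.mem_filter] at hv
    exact hv.2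
  · intro v hv
    rw [Multiset.mem_toList, Multiset.mem_filter] at hv
    exact hv.2

theorem normalForm_ofNormalForm {n : ℕ} (p : MvPolynomial (Var n) ℂ) :
    normalForm n (ofNormalForm n p) = p := by
  have hc : normalForm n ∘ₗ ofNormalForm n = LinearMap.id := by
    refine (basisMonomials (Var n) ℂ).ext fun α => ?_
    simp only [LinearMap.comp_apply, ofNormalForm, Module.Basis.constr_basis]
    rw [normalForm_normalMonomial]
    simp
  exact LinearMap.congr_fun hc p

lemma gen_comm {n : ℕ} {u v : Var n} (huv : u.base ≠ some v) (hvu : v.base ≠ some u) :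
    (gen u : HWeyl n) * gen v = gen v * gen u := by
  simpa [gen] using RingQuot.mkAlgHom_rel ℂ (HRel.comm u v huv hvu)

lemma gen_weyl {n : ℕ} {u v : Var n} (huv : u.base = some v) :
    (gen u : HWeyl n) * gen v = gen v * gen u + gen Var.h ^ 2 := by
  simpa [gen] using RingQuot.mkAlgHom_rel ℂ (HRel.weyl u v huv)

lemma words_perm {n : ℕ} {l l' : List (Var n)} (hp : l.Perm l')
    (hc : (∀ v ∈ l, v.base.isNone) ∨ (∀ v ∈ l, ¬ v.base.isNone)) :
    (l.map (gen : Var n → HWeyl n)).prod = (l'.map gen).prod := by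
  refine (hp.map gen).prod_eq' ?_
  rw [List.pairwise_map]
  refine List.Pairwise.imp_of_mem (R := fun _ _ => True) ?_ (by simp [List.pairwise_iff_forall_sublist])
  intro u v hu hv _
  refine gen_comm ?_ ?_
  · intro e
    have h0 := Var.base_of_base e
    rcases hc with hc | hc
    · simpa [e] using hc u hu
    · exact hc v hv (by simp [h0])
  · intro e
    have h0 := Var.base_of_base e
    rcases hc with hc | hc
    · simpa [e] using hc v hv
    · exact hc u hu (by simp [h0])

lemma ofNormalForm_words {n : ℕ} (l₁ l₂ : List (Var n)) (h₁ : ∀ v ∈ l₁, v.base.isNone)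
    (h₂ : ∀ v ∈ l₂, ¬ v.base.isNone) :
    ofNormalForm n ((l₁.map X).prod * (l₂.map X).prod) =
      (l₁.map gen).prod * (l₂.map gen).prod := by
  classical
  have e : ((l₁.map X).prod * (l₂.map X).prod : MvPolynomial (Var n) ℂ) =
      basisMonomials (Var n) ℂ (Multiset.toFinsupp ((l₁ : Multiset (Var n)) + l₂)) := by
    rw [coe_basisMonomials]
    beta_reduce
    rw [← prod_map_X, Multiset.toFinsupp_toMultiset, Multiset.map_add,
      Multiset.prod_add]
    simp
  rw [e, ofNormalForm, Module.Basis.constr_basis, normalMonomial, Multiset.toFinsupp_toMultiset,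
    Multiset.filter_add, Multiset.filter_add,
    Multiset.filter_eq_self.2 (by simpa using h₁), Multiset.filter_eq_nil.2 (by simpa using h₂),
    Multiset.filter_eq_nil.2 (by simpa using h₁), Multiset.filter_eq_self.2 (by simpa using h₂),
    add_zero, zero_add]
  congr 1
  · exact (words_perm (Multiset.coe_eq_coe.1 (by simp)) (Or.inl h₁)).symm
  · exact (words_perm (Multiset.coe_eq_coe.1 (by simp)) (Or.inr h₂)).symm

/-- The span of all normally ordered words. -/
def wordSpan (n : ℕ) : Submodule ℂ (HWeyl n) :=
  Submodule.span ℂ {f | ∃ l₁ l₂ : List (Var n), (∀ v ∈ l₁, v.base.isNone) ∧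
    (∀ v ∈ l₂, ¬ v.base.isNone) ∧ f = (l₁.map gen).prod * (l₂.map gen).prod}

lemma gen_mul_mem_of_none {n : ℕ} {u : Var n} (hu : u.base.isNone) {f : HWeyl n}
    (hf : f ∈ wordSpan n) : gen u * f ∈ wordSpan n := by
  induction hf using Submodule.span_induction with
  | mem f hf =>
    obtain ⟨l₁, l₂, h₁, h₂, rfl⟩ := hf
    exact Submodule.subset_span ⟨u :: l₁, l₂, by simpa using ⟨by simpa using hu, by simpa using h₁⟩,
      h₂, by simp [mul_assoc]⟩
  | zero => simp
  | add f g _ _ hf hg => rw [mul_add]; exact add_mem hf hg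
  | smul c f _ hf => rw [mul_smul_comm]; exact Submodule.smul_mem _ _ hf

lemma gen_mul_mem {n : ℕ} (u : Var n) {f : HWeyl n}
    (hf : f ∈ wordSpan n) : gen u * f ∈ wordSpan n := by
  by_cases hu : u.base.isNone
  · exact gen_mul_mem_of_none hu hf
  induction hf using Submodule.span_induction with
  | mem f hf =>
    obtain ⟨l₁, l₂, h₁, h₂, rfl⟩ := hf
    induction l₁ with
    | nil =>
      exact Submodule.subset_span ⟨[], u :: l₂, by simp,
        by simpa using ⟨by simpa using hu, by simpa using h₂⟩, by simp⟩
    | cons v l ih =>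
      have hl : ∀ w ∈ l, w.base.isNone := fun w hw => h₁ w (List.mem_cons_of_mem _ hw)
      have hv : v.base.isNone := h₁ v (by simp)
      have ih' := gen_mul_mem_of_none hv (ih hl)
      simp only [List.map_cons, List.prod_cons]
      by_cases huv : u.base = some v
      · have e : gen u * (gen v * (l.map gen).prod * (l₂.map gen).prod) =
            gen v * (gen u * ((l.map gen).prod * (l₂.map gen).prod)) +
              gen Var.h * (gen Var.h * ((l.map gen).prod * (l₂.map gen).prod) : HWeyl n) := by
          rw [mul_assoc, ← mul_assoc, gen_weyl huv]
          noncomm_ring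
        rw [e]
        exact add_mem ih' (gen_mul_mem_of_none rfl (gen_mul_mem_of_none rfl
          (Submodule.subset_span ⟨l, l₂, hl, h₂, rfl⟩)))
      · have e : gen u * (gen v * (l.map gen).prod * (l₂.map gen).prod) =
            gen v * (gen u * ((l.map gen).prod * (l₂.map gen).prod) : HWeyl n) := by
          rw [mul_assoc, ← mul_assoc, gen_comm huv
            (by rw [Option.isNone_iff_eq_none] at hv; simp [hv])]
          noncomm_ring
        rw [e]
        exact ih'
  | zero => simp
  | add f g _ _ hf hg => rw [mul_add]; exact add_mem hf hg
  | smul c f _ hf => rw [mul_smul_comm]; exact Submodule.smul_mem _ _ hf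

lemma mem_wordSpan {n : ℕ} (f : HWeyl n) : f ∈ wordSpan n := by
  obtain ⟨s, rfl⟩ := RingQuot.mkAlgHom_surjective ℂ (HRel n) f
  have key : ∀ s : FreeAlgebra ℂ (Var n), ∀ g ∈ wordSpan n,
      RingQuot.mkAlgHom ℂ (HRel n) s * g ∈ wordSpan n := by
    intro s
    induction s using FreeAlgebra.induction with
    | grade0 c =>
      intro g hg
      rw [AlgHom.commutes, ← Algebra.smul_def]
      exact Submodule.smul_mem _ _ hg
    | grade1 v => exact fun g hg => gen_mul_mem v hg
    | mul s t hs ht =>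
      intro g hg
      rw [map_mul, mul_assoc]
      exact hs _ (ht g hg)
    | add s t hs ht =>
      intro g hg
      rw [map_add, add_mul]
      exact add_mem (hs g hg) (ht g hg)
  simpa using key s 1 (Submodule.subset_span ⟨[], [], by simp, by simp, by simp⟩)

/-- Together with `normalForm_ofNormalForm`: the normally ordered monomials are a basis of the
homogenized Weyl algebra, and `normalForm` gives the coordinates in it. -/
theorem ofNormalForm_normalForm {n : ℕ} (f : HWeyl n) :
    ofNormalForm n (normalForm n f) = f := by
  have hf := mem_wordSpan f
  induction hf using Submodule.span_induction with
  | mem f hf =>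
    obtain ⟨l₁, l₂, h₁, h₂, rfl⟩ := hf
    rw [normalForm_words l₁ l₂ h₁ h₂, ofNormalForm_words l₁ l₂ h₁ h₂]
  | zero => simp
  | add f g _ _ hf hg => rw [map_add, map_add, hf, hg]
  | smul c f _ hf => rw [map_smul, map_smul, hf]

/-! ### The term order -/

/-- A choice of a term order inside each block of several variables, except for the block of the
`b_i`, whose order is prescribed. -/
structure TieBreaker (n : ℕ) where
  /-- the block of the `a_{pq}`, `p ≤ q` -/
  a : MonomialOrder.{0, 0} (Sym2 (Fin (n + 1)))
  /-- the block of the `c_i` -/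
  c : MonomialOrder.{0, 0} (Fin (n + 1))
  /-- the block of the `y_i` -/
  y : MonomialOrder.{0, 0} (Fin (n + 1))
  /-- the block of the `∂_{ij}`, `i < j` -/
  dxOff : MonomialOrder.{0, 0} {p : Sym2 (Fin (n + 1)) // ¬ p.IsDiag}
  /-- the block of the `∂_{ii}` -/
  dxDiag : MonomialOrder.{0, 0} (Fin (n + 1))
  /-- the block of the `∂_i` -/
  dy : MonomialOrder.{0, 0} (Fin (n + 1))
  /-- the block of the `x_{ij}`, `i < j` -/
  xOff : MonomialOrder.{0, 0} {p : Sym2 (Fin (n + 1)) // ¬ p.IsDiag}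
  /-- the block of the `x_{ii}` -/
  xDiag : MonomialOrder.{0, 0} (Fin (n + 1))

/-- The exponents of the variables `v i` in a monomial. -/
noncomputable def exps {n : ℕ} {ι : Type} [Finite ι] (v : ι → Var n) :
    (Var n →₀ ℕ) →+ (ι →₀ ℕ) where
  toFun α := Finsupp.equivFunOnFinite.symm fun i => α (v i)
  map_zero' := by ext; simp
  map_add' α β := by ext; simp

/-- The exponent of the variable `v` in a monomial. -/
def expo {n : ℕ} (v : Var n) : (Var n →₀ ℕ) →+ ℕ := Finsupp.applyAddHom v

/-- The values of the comparisons, in their order of priority. -/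
abbrev Key {n : ℕ} (T : TieBreaker n) : Type :=
  ℕ ×ₗ ℤ ×ₗ ℕ ×ₗ ℕ ×ₗ T.a.syn ×ₗ (MonomialOrder.lex (σ := Fin (n + 1))).syn ×ₗ T.c.syn ×ₗ T.y.syn
    ×ₗ ℕ ×ₗ T.dxOff.syn ×ₗ T.dxDiag.syn ×ₗ T.dy.syn ×ₗ T.xOff.syn ×ₗ T.xDiag.syn ×ₗ ℕ

/-- What the order compares, lexicographically: the total degree, the `(-w, w, 0)`-degree, and then
the blocks `d ≫ r ≫ {a_{pq}} ≫ {b_i} ≫ {c_i} ≫ {y_i} ≫ ∂_r ≫ {∂_{ij} | i < j} ≫ {∂_{ii}} ≫ {∂_i}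
≫ {x_{ij} | i < j} ≫ {x_{ii}} ≫ h`, with `b_1 > b_2 > ⋯` lexicographically. -/
noncomputable def key {n : ℕ} (T : TieBreaker n) (α : Var n →₀ ℕ) : Key T :=
  toLex (α.degree, toLex (Finsupp.weight Var.weight α,
  toLex (expo .d α, toLex (expo .r α,
  toLex (T.a.toSyn (exps .a α), toLex (MonomialOrder.lex.toSyn (exps .b α),
  toLex (T.c.toSyn (exps .c α), toLex (T.y.toSyn (exps .y α),
  toLex (expo .dr α,
  toLex (T.dxOff.toSyn (exps (fun p => .dx p.1) α),
  toLex (T.dxDiag.toSyn (exps (fun i => .dx s(i, i)) α),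
  toLex (T.dy.toSyn (exps .dy α),
  toLex (T.xOff.toSyn (exps (fun p => .x p.1) α),
  toLex (T.xDiag.toSyn (exps (fun i => .x s(i, i)) α), expo .h α))))))))))))))

lemma key_add {n : ℕ} (T : TieBreaker n) (α β : Var n →₀ ℕ) :
    key T (α + β) = key T α + key T β := by
  simp only [key, map_add]
  rfl

lemma key_injective {n : ℕ} (T : TieBreaker n) : Function.Injective (key T) := by
  intro α β hαβ
  simp only [key, EmbeddingLike.apply_eq_iff_eq, Prod.mk.injEq] at hαβ
  obtain ⟨-, -, hd, hr, ha, hb, hc, hy, hdr, hdo, hdd, hdy, hxo, hxd, hh⟩ := hαβ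
  ext v
  cases v with
  | a p => simpa [exps] using DFunLike.congr_fun ha p
  | b i => simpa [exps] using DFunLike.congr_fun hb i
  | c i => simpa [exps] using DFunLike.congr_fun hc i
  | d => exact hd
  | x p =>
    by_cases hp : p.IsDiag
    · obtain ⟨i, rfl⟩ : ∃ i, s(i, i) = p := ⟨p.diagElem hp, Sym2.diag_diagElem hp⟩
      simpa [exps] using DFunLike.congr_fun hxd i
    · simpa [exps] using DFunLike.congr_fun hxo ⟨p, hp⟩
  | y i => simpa [exps] using DFunLike.congr_fun hy i
  | r => exact hr
  | dx p =>
    by_cases hp : p.IsDiag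
    · obtain ⟨i, rfl⟩ : ∃ i, s(i, i) = p := ⟨p.diagElem hp, Sym2.diag_diagElem hp⟩
      simpa [exps] using DFunLike.congr_fun hdd i
    · simpa [exps] using DFunLike.congr_fun hdo ⟨p, hp⟩
  | dy i => simpa [exps] using DFunLike.congr_fun hdy i
  | dr => exact hdr
  | h => exact hh

lemma key_zero {n : ℕ} (T : TieBreaker n) : key T 0 = 0 := by
  simp only [key, map_zero]
  rfl

/-- `key` as an additive homomorphism. -/
noncomputable def keyHom {n : ℕ} (T : TieBreaker n) : (Var n →₀ ℕ) →+ Key T where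
  toFun := key T
  map_zero' := key_zero T
  map_add' := key_add T

lemma key_monotone {n : ℕ} (T : TieBreaker n) : Monotone (key T) := by
  intro α β hαβ
  obtain ⟨γ, rfl⟩ := exists_add_of_le hαβ
  by_cases hγ : γ = 0
  · simp [hγ]
  · have h0 : α.degree < (α + γ).degree := by
      have h1 : γ.degree ≠ 0 := by simpa [Finsupp.degree_eq_zero_iff] using hγ
      rw [map_add]
      omega
    exact le_of_lt (Prod.Lex.toLex_lt_toLex.2 (Or.inl h0))

/-- Exponents, identified with their values under `key`. -/
noncomputable def keyEquiv {n : ℕ} (T : TieBreaker n) :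
    (Var n →₀ ℕ) ≃+ AddMonoidHom.mrange (keyHom T) :=
  AddEquiv.ofBijective (keyHom T).mrangeRestrict
    ⟨fun _ _ e => key_injective T (congrArg Subtype.val e), (keyHom T).mrangeRestrict_surjective⟩

lemma keyEquiv_monotone {n : ℕ} (T : TieBreaker n) : Monotone (keyEquiv T) :=
  fun _ _ h => key_monotone T h

/-- The term order `<^h_{(-w, w, 0)}`: exponents are compared through their values under `key`. -/
noncomputable def termOrder {n : ℕ} (T : TieBreaker n) : MonomialOrder (Var n) where
  syn := AddMonoidHom.mrange (keyHom T)
  toSyn := keyEquiv T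
  toSyn_monotone := keyEquiv_monotone T
  wellFoundedLT_syn :=
    have := (keyEquiv_monotone T).wellQuasiOrderedLE_of_wellQuasiOrderedLE_of_surjective
      (keyEquiv T).surjective
    inferInstance

theorem termOrder_lt_iff {n : ℕ} (T : TieBreaker n) (α β : Var n →₀ ℕ) :
    α ≺[termOrder T] β ↔ key T α < key T β :=
  Iff.rfl

/-! ### Gröbner bases -/

/-- The initial monomial of an element, with its coefficient, in the associated commutative
polynomial ring. -/
noncomputable def initial {n : ℕ} (m : MonomialOrder (Var n)) (f : HWeyl n) :
    MvPolynomial (Var n) ℂ :=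
  m.leadingTerm (normalForm n f)

/-- `G` is a Gröbner basis of the left ideal `I`: it is finite, it generates `I` as a left ideal,
and the initial monomials of its elements generate the initial ideal of `I`. (In Mathlib, an
`Ideal` of a noncommutative ring is a left ideal.) -/
def IsGroebnerBasis {n : ℕ} (m : MonomialOrder (Var n)) (G : Set (HWeyl n))
    (I : Ideal (HWeyl n)) : Prop :=
  G.Finite ∧ Ideal.span G = I ∧
    Ideal.span (initial m '' G) = Ideal.span (initial m '' (I : Set (HWeyl n)))

/-! ### The homogenized system -/

section Generators

variable {n : ℕ}

/-- The slack variable `a_{pq} = a_{qp}`. -/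
noncomputable abbrev av (p q : Fin (n + 1)) : HWeyl n := gen (.a s(p, q))
/-- The slack variable `b_i`. -/
noncomputable abbrev bv (i : Fin (n + 1)) : HWeyl n := gen (.b i)
/-- The slack variable `c_i`. -/
noncomputable abbrev cv (i : Fin (n + 1)) : HWeyl n := gen (.c i)
/-- The slack variable `d`. -/
noncomputable abbrev dv : HWeyl n := gen .d
/-- The space variable `x_{ij} = x_{ji}`. -/
noncomputable abbrev xv (i j : Fin (n + 1)) : HWeyl n := gen (.x s(i, j))
/-- The space variable `y_i`. -/
noncomputable abbrev yv (i : Fin (n + 1)) : HWeyl n := gen (.y i)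
/-- The space variable `r`. -/
noncomputable abbrev rv : HWeyl n := gen .r
/-- The operator `∂_{ij} = ∂_{ji}`. -/
noncomputable abbrev dxv (i j : Fin (n + 1)) : HWeyl n := gen (.dx s(i, j))
/-- The operator `∂_i`. -/
noncomputable abbrev dyv (i : Fin (n + 1)) : HWeyl n := gen (.dy i)
/-- The operator `∂_r`. -/
noncomputable abbrev drv : HWeyl n := gen .dr
/-- The homogenization variable `h`. -/
noncomputable abbrev hv : HWeyl n := gen .h

/-- `A'^h_{pq}` -/
noncomputable def genA (p q : Fin (n + 1)) : HWeyl n :=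
  hv * xv p q * dxv p q - xv p q * dyv p * dyv q - av p q ^ 3

/-- `B` -/
noncomputable def genB (n : ℕ) : HWeyl n :=
  ∑ i, dyv i ^ 2 - rv ^ 2

/-- `C'^h_{ij}` -/
noncomputable def genC (i j : Fin (n + 1)) : HWeyl n :=
  xv i j * dyv i ^ 2 + 2 * (xv j j - xv i i) * dyv i * dyv j - xv i j * dyv j ^ 2
    + ∑ s with s ≠ i ∧ s ≠ j, (xv s j * dyv i * dyv s - xv i s * dyv j * dyv s)
    + (hv * yv j + bv j * cv j) * dyv i - (hv * yv i + bv i * cv i) * dyv j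

/-- `E'^h` -/
noncomputable def genE (n : ℕ) : HWeyl n :=
  hv * rv * drv
    - 2 * ∑ i : Fin (n + 1), ∑ j with i ≤ j, xv i j * dyv i * dyv j
    - ∑ i, (hv * yv i + bv i * cv i) * dyv i - (n : HWeyl n) * hv ^ 3 - dv ^ 3

/-- The set `G'^h` of generators: `A'^h_{pq}` for `p ≤ q`, `B`, `C'^h_{ij}` for `i < j`, `E'^h`. -/
def homogGens (n : ℕ) : Set (HWeyl n) :=
  {f | ∃ p q, p ≤ q ∧ f = genA p q} ∪ {genB n} ∪ {f | ∃ i j, i < j ∧ f = genC i j} ∪ {genE n}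

/-- The left ideal `I'^h` generated by `G'^h`. -/
def homogIdeal (n : ℕ) : Ideal (HWeyl n) :=
  Ideal.span (homogGens n)

end Generators

end FisherBingham

/-!
The proof is Buchberger's algorithm, carried out for a structured form of the generators. In the
notation `φ_i = x_{ii} ∂_i + ∑_s x_{is} ∂_s + h y_i + b_i c_i` (`phi`) they read

* `A_{pq} = x_{pq} (h ∂_{pq} - ∂_p ∂_q) - a_{pq}^3`,
* `B = ∑_i ∂_i^2 - r^2`,
* `C_{ij} = φ_j ∂_i - φ_i ∂_j`,
* `E = h r ∂_r - ∑_i φ_i ∂_i - n h^3 - d^3`,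

and `∂_i`, `φ_i` behave like the operators and variables of a Weyl algebra: the `φ_i` commute with
one another, and `[∂_i, φ_j] = δ_{ij} h^3`. Moreover `h ∂_{pq} - ∂_p ∂_q` commutes with all `∂_i`
and `φ_i`. Hence `C_{ij}` are the infinitesimal rotations and `∑_i φ_i ∂_i` is the Euler operator:
`A_{pq}` commutes with all generators, `B` and `E` commute with all `C_{ij}`, and
`[B, E] = -2 h^3 B`.

The initial monomial of `φ_i` is `b_i c_i`, and those of the generators are `a_{pq}^3`, `r^2`,
`b_i c_i ∂_j` (`i < j`) and `d^3`. Two of them are coprime unless they are `b_i c_i ∂_j` and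
`b_k c_k ∂_l` with `i = k` or `j = l`. The S-pair of generators with coprime initial monomials is
their commutator, up to smaller terms, and is thereby dealt with; in the two remaining cases a
standard representation of the S-pair is given by the Laplace expansions
`∂_l C_{ij} - ∂_j C_{il} + ∂_i C_{jl} = 0` and `φ_k C_{ij} - φ_i C_{kj} - φ_j C_{ik} = 0`
(`dy_mul_sysC`, `phi_mul_sysC`).

Buchberger's criterion (`exists_lead_le_degree`) holds in the homogenized Weyl algebra because the
correction term `h ^ 2` of `∂ v = v ∂ + h ^ 2` is smaller than the monomial `∂ v`, so that leading
terms multiply as in the commutative polynomial ring (`HasLead.mul`).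
-/

namespace FisherBingham

open MvPolynomial
open scoped MonomialOrder

variable {n : ℕ}

/-! ### Leading terms in the homogenized Weyl algebra -/

variable {m : MonomialOrder (Var n)}

/-- `HasLead m f γ c` says that the normally ordered expression of `f` has only monomials up to
`γ`, with coefficient `c` at `γ`. As `c = 0` is allowed, this covers both the elements with
initial monomial `γ` and those all of whose monomials lie below `γ`. -/
def HasLead (m : MonomialOrder (Var n)) (f : HWeyl n) (γ : Var n →₀ ℕ) (c : ℂ) : Prop :=
  m.degree (normalForm n f) ≼[m] γ ∧ (normalForm n f).coeff γ = c

/-- The compatibility of a term order with the relations: the term `h ^ 2` of `∂ v - v ∂` is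
smaller than the monomial `∂ v`. -/
def IsWeylOrder (m : MonomialOrder (Var n)) : Prop :=
  ∀ u v : Var n, u.base = some v →
    Finsupp.single Var.h 2 ≺[m] (Finsupp.single u 1 + Finsupp.single v 1)

lemma normalForm_eq_zero {f : HWeyl n} (h : normalForm n f = 0) : f = 0 := by
  rw [← ofNormalForm_normalForm f, h, map_zero]

namespace HasLead

variable {f g : HWeyl n} {γ δ : Var n →₀ ℕ} {c d : ℂ}

lemma zero_iff : HasLead m f γ 0 ↔ ∀ α ∈ (normalForm n f).support, α ≺[m] γ := by
  constructor
  · rintro ⟨h1, h2⟩ α hα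
    refine lt_of_le_of_ne ((m.le_degree hα).trans h1) fun e => ?_
    rw [m.toSyn.injective e] at hα
    exact mem_support_iff.1 hα h2
  · intro h
    refine ⟨m.degree_le_iff.2 fun α hα => (h α hα).le, ?_⟩
    by_contra h0
    exact lt_irrefl _ (h γ (mem_support_iff.2 h0))

lemma iff_forall : HasLead m f γ c ↔
    (∀ α ∈ (normalForm n f).support, α ≼[m] γ) ∧ (normalForm n f).coeff γ = c := by
  rw [HasLead, m.degree_le_iff]

lemma congr (hf : HasLead m f γ c) (h : f = g) (hc : c = d) : HasLead m g γ d :=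
  h ▸ hc ▸ hf

lemma add (hf : HasLead m f γ c) (hg : HasLead m g γ d) : HasLead m (f + g) γ (c + d) := by
  refine ⟨?_, by rw [map_add, coeff_add, hf.2, hg.2]⟩
  rw [map_add]
  exact m.degree_add_le.trans (max_le hf.1 hg.1)

lemma smul (hf : HasLead m f γ c) (a : ℂ) : HasLead m (a • f) γ (a * c) := by
  refine ⟨?_, by rw [map_smul, coeff_smul, hf.2, smul_eq_mul]⟩
  rw [map_smul]
  exact m.degree_smul_le.trans hf.1

lemma neg (hf : HasLead m f γ c) : HasLead m (-f) γ (-c) := by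
  rw [HasLead, map_neg, m.degree_neg, coeff_neg, hf.2]
  exact ⟨hf.1, rfl⟩

lemma sub (hf : HasLead m f γ c) (hg : HasLead m g γ d) : HasLead m (f - g) γ (c - d) := by
  simpa [sub_eq_add_neg] using hf.add hg.neg

lemma zero (m : MonomialOrder (Var n)) (γ : Var n →₀ ℕ) : HasLead m 0 γ 0 := by
  rw [zero_iff]; simp

lemma sum {ι : Type*} (s : Finset ι) {F : ι → HWeyl n}
    (h : ∀ i ∈ s, HasLead m (F i) γ 0) : HasLead m (∑ i ∈ s, F i) γ 0 := by
  refine Finset.sum_induction F (fun f => HasLead m f γ 0) ?_ (zero m γ) h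
  intro f g hf hg
  simpa using hf.add hg

lemma of_lt (hf : HasLead m f γ c) (h : γ ≺[m] δ) : HasLead m f δ 0 :=
  zero_iff.2 fun _ hα => ((m.le_degree hα).trans hf.1).trans_lt h

lemma self (m : MonomialOrder (Var n)) (f : HWeyl n) :
    HasLead m f (m.degree (normalForm n f)) (m.leadingCoeff (normalForm n f)) :=
  ⟨le_rfl, rfl⟩

lemma normalMonomial (m : MonomialOrder (Var n)) (γ : Var n →₀ ℕ) :
    HasLead m (normalMonomial γ) γ 1 := by
  rw [HasLead, normalForm_normalMonomial]
  exact ⟨m.degree_monomial_le 1, by classical simp⟩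

lemma one (m : MonomialOrder (Var n)) : HasLead m (1 : HWeyl n) 0 1 := by
  rw [HasLead, normalForm_one, m.degree_one]
  exact ⟨le_rfl, coeff_zero_one⟩

lemma degree_eq (hf : HasLead m f γ c) (hc : c ≠ 0) : m.degree (normalForm n f) = γ := by
  refine m.toSyn.injective (le_antisymm hf.1 (m.le_degree ?_))
  rw [mem_support_iff, hf.2]
  exact hc

/-- Left multiplication by a generator: the correction term `h ^ 2 ∂/∂v` is smaller than the
commutative product. -/
lemma gen_mul (hm : IsWeylOrder m) (u : Var n) (hg : HasLead m g δ d) :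
    HasLead m (gen u * g) (Finsupp.single u 1 + δ) d := by
  have hX : ∀ p : MvPolynomial (Var n) ℂ, m.degree p ≼[m] δ → p.coeff δ = d →
      m.degree (X u * p) ≼[m] (Finsupp.single u 1 + δ) ∧
      (X u * p).coeff (Finsupp.single u 1 + δ) = d := by
    intro p h1 h2
    refine ⟨m.degree_mul_le.trans ?_, by rw [coeff_X_mul, h2]⟩
    rw [map_add, map_add]
    exact add_le_add m.degree_X_le_single h1
  obtain ⟨h1, h2⟩ := hX _ hg.1 hg.2
  rw [HasLead, normalForm_gen_mul]
  rcases hu : u.base with _ | v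
  · rw [leftMul_of_none hu]
    exact ⟨h1, h2⟩
  rw [leftMul_of_some hu]
  set p := normalForm n g with hp
  have hlow : ∀ α ∈ (X Var.h ^ 2 * pderiv v p).support, α ≺[m] (Finsupp.single u 1 + δ) := by
    classical
    intro α hα
    rw [p.as_sum, map_sum, Finset.mul_sum] at hα
    obtain ⟨β, hβ, hα⟩ := Finset.mem_biUnion.1 (support_sum hα)
    rw [pderiv_monomial, X_pow_eq_monomial, monomial_mul] at hα
    obtain rfl := Finset.mem_singleton.1 (support_monomial_subset hα)
    have hv : β v ≠ 0 := by
      intro h0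
      simp [h0] at hα
    have hle : Finsupp.single v 1 ≤ β := Finsupp.single_le_iff.2 (Nat.one_le_iff_ne_zero.2 hv)
    have hβδ : β ≼[m] δ := (m.le_degree hβ).trans hg.1
    have e : Finsupp.single u 1 + β =
        (Finsupp.single u 1 + Finsupp.single v 1) + (β - Finsupp.single v 1) := by
      rw [add_assoc, add_tsub_cancel_of_le hle]
    have hlt : (Finsupp.single Var.h 2 + (β - Finsupp.single v 1)) ≺[m]
        (Finsupp.single u 1 + β) := by
      rw [e, map_add, map_add _ (_ + _)]
      exact add_lt_add_left (hm u v hu) _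
    refine hlt.trans_le ?_
    rw [map_add, map_add]
    gcongr
  refine ⟨m.degree_add_le.trans (max_le h1 (m.degree_le_iff.2 fun α hα => (hlow α hα).le)), ?_⟩
  rw [coeff_add, h2]
  have : (X Var.h ^ 2 * pderiv v p).coeff (Finsupp.single u 1 + δ) = 0 := by
    by_contra h0
    exact lt_irrefl _ (hlow _ (mem_support_iff.2 h0))
  rw [this, add_zero]

lemma gen (hm : IsWeylOrder m) (u : Var n) : HasLead m (gen u) (Finsupp.single u 1) 1 := by
  simpa using (one m).gen_mul hm u

lemma normalMonomial_mul (hm : IsWeylOrder m) (α : Var n →₀ ℕ) (hg : HasLead m g δ d) :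
    HasLead m (FisherBingham.normalMonomial α * g) (α + δ) d := by
  have key : ∀ (l : List (Var n)) (g : HWeyl n) (δ : Var n →₀ ℕ), HasLead m g δ d →
      HasLead m ((l.map FisherBingham.gen).prod * g)
        ((l.map fun v => Finsupp.single v 1).sum + δ) d := by
    intro l
    induction l with
    | nil => intro g δ h; simpa using h
    | cons v l ih =>
      intro g δ h
      simpa [mul_assoc, add_assoc] using (ih g δ h).gen_mul hm v
  have h := key ((Finsupp.toMultiset α).filter (fun v => v.base.isNone)).toList _ _
    (key ((Finsupp.toMultiset α).filter (fun v => ¬ v.base.isNone)).toList g δ hg)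
  rw [← mul_assoc, ← add_assoc] at h
  convert h using 2
  · rfl
  rw [← Multiset.sum_coe, ← Multiset.sum_coe, ← Multiset.map_coe, ← Multiset.map_coe,
    Multiset.coe_toList, Multiset.coe_toList, ← Multiset.sum_add, ← Multiset.map_add,
    Multiset.filter_add_not]
  clear h
  induction α using Finsupp.induction_linear with
  | zero => simp
  | add α β hα hβ => rw [map_add, Multiset.map_add, Multiset.sum_add, ← hα, ← hβ]
  | single v k => simp [Finsupp.toMultiset_single, Multiset.map_nsmul, Multiset.sum_nsmul]

/-- Leading coefficients are multiplicative, as in the associated commutative ring. -/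
lemma mul (hm : IsWeylOrder m) (hf : HasLead m f γ c) (hg : HasLead m g δ d) :
    HasLead m (f * g) (γ + δ) (c * d) := by
  -- The part of `f` below `γ` contributes nothing at `γ + δ`.
  have hlow : ∀ f : HWeyl n, HasLead m f γ 0 → HasLead m (f * g) (γ + δ) 0 := by
    intro f hf
    rw [← ofNormalForm_normalForm f, (normalForm n f).as_sum, map_sum, Finset.sum_mul]
    refine sum _ fun α hα => ?_
    have e : ofNormalForm n (monomial α (coeff α (normalForm n f))) =
        coeff α (normalForm n f) • FisherBingham.normalMonomial α := by
      have : monomial α (coeff α (normalForm n f)) =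
          coeff α (normalForm n f) • basisMonomials (Var n) ℂ α := by simp [smul_monomial]
      rw [this, map_smul, ofNormalForm, Module.Basis.constr_basis]
    rw [e, smul_mul_assoc]
    refine ((hg.normalMonomial_mul hm α).smul _).of_lt ?_
    rw [map_add, map_add]
    exact add_lt_add_left (zero_iff.1 hf α hα) _
  have h1 := hlow (f - c • FisherBingham.normalMonomial γ)
    (by simpa using hf.sub ((normalMonomial m γ).smul c))
  simpa [sub_mul] using h1.add ((hg.normalMonomial_mul hm γ).smul c)

lemma pow (hm : IsWeylOrder m) (hf : HasLead m f γ c) (k : ℕ) :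
    HasLead m (f ^ k) (k • γ) (c ^ k) := by
  induction k with
  | zero => simpa using one m
  | succ k ih =>
    rw [pow_succ, pow_succ, succ_nsmul]
    exact ih.mul hm hf

end HasLead

/-! ### Buchberger's criterion -/

section Criterion

variable {ι : Type*} {g : ι → HWeyl n} {lead : ι → Var n →₀ ℕ}

/-- The combinations of the `g i` whose terms `u * g i` have all their exponents, computed
commutatively as the exponents of `u` plus `lead i`, in `S`. For `S` the set of exponents below
`γ`, these are the elements with a standard representation below `γ`. -/
def repSpan (g : ι → HWeyl n) (lead : ι → Var n →₀ ℕ) (S : Set (Var n →₀ ℕ)) :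
    Submodule ℂ (HWeyl n) :=
  Submodule.span ℂ {f | ∃ i u, (∀ α ∈ (normalForm n u).support, α + lead i ∈ S) ∧ f = u * g i}

lemma repSpan_mono {S S' : Set (Var n →₀ ℕ)} (h : S ⊆ S') :
    repSpan g lead S ≤ repSpan g lead S' :=
  Submodule.span_mono fun _ ⟨i, u, hu, e⟩ => ⟨i, u, fun α hα => h (hu α hα), e⟩

lemma mul_mem_repSpan_of_support {S : Set (Var n →₀ ℕ)} {u : HWeyl n} {i : ι}
    (hu : ∀ α ∈ (normalForm n u).support, α + lead i ∈ S) : u * g i ∈ repSpan g lead S :=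
  Submodule.subset_span ⟨i, u, hu, rfl⟩

lemma mul_mem_repSpan_of_lt {u : HWeyl n} {i : ι} {σ γ : Var n →₀ ℕ} {c : ℂ}
    (hu : HasLead m u σ c) (h : (σ + lead i) ≺[m] γ) :
    u * g i ∈ repSpan g lead {δ | δ ≺[m] γ} := by
  refine mul_mem_repSpan_of_support fun α hα => lt_of_le_of_lt ?_ h
  rw [map_add, map_add]
  exact add_le_add_left ((m.le_degree hα).trans hu.1) _

lemma mul_mem_repSpan_of_zero {u : HWeyl n} {i : ι} {σ γ : Var n →₀ ℕ}
    (hu : HasLead m u σ 0) (h : σ + lead i = γ) :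
    u * g i ∈ repSpan g lead {δ | δ ≺[m] γ} := by
  refine mul_mem_repSpan_of_support fun α hα => ?_
  rw [← h, Set.mem_ofPred_eq, map_add, map_add]
  exact add_lt_add_left (HasLead.zero_iff.1 hu α hα) _

lemma mul_mem_repSpan_lt (hm : IsWeylOrder m) {w : HWeyl n} {ω γ : Var n →₀ ℕ} {c : ℂ}
    (hw : HasLead m w ω c) {f : HWeyl n} (hf : f ∈ repSpan g lead {δ | δ ≺[m] γ}) :
    w * f ∈ repSpan g lead {δ | δ ≺[m] (ω + γ)} := by
  induction hf using Submodule.span_induction with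
  | mem f hf =>
    obtain ⟨i, u, hu, rfl⟩ := hf
    rw [← mul_assoc]
    by_cases h0 : normalForm n u = 0
    · have := normalForm_eq_zero h0
      simp [this]
    · refine mul_mem_repSpan_of_lt (hw.mul hm (HasLead.self m u)) ?_
      rw [add_assoc, map_add, map_add _ ω]
      exact add_lt_add_right (hu _ (m.degree_mem_support h0)) _
  | zero => simp
  | add f f' _ _ h h' => rw [mul_add]; exact add_mem h h'
  | smul a f _ h => rw [mul_smul_comm]; exact Submodule.smul_mem _ _ h

lemma mul_mem_repSpan_le (hm : IsWeylOrder m) {w : HWeyl n} {ω γ : Var n →₀ ℕ} {c : ℂ}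
    (hw : HasLead m w ω c) {f : HWeyl n} (hf : f ∈ repSpan g lead {δ | δ ≼[m] γ}) :
    w * f ∈ repSpan g lead {δ | δ ≼[m] (ω + γ)} := by
  induction hf using Submodule.span_induction with
  | mem f hf =>
    obtain ⟨i, u, hu, rfl⟩ := hf
    rw [← mul_assoc]
    by_cases h0 : normalForm n u = 0
    · have := normalForm_eq_zero h0
      simp [this]
    · refine mul_mem_repSpan_of_support fun α hα => ?_
      have h1 := (m.le_degree hα).trans (hw.mul hm (HasLead.self m u)).1
      have h2 := hu _ (m.degree_mem_support h0)
      rw [Set.mem_ofPred_eq, map_add] at h2 ⊢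
      rw [map_add] at h1 ⊢
      calc _ ≤ _ := add_le_add_left h1 _
        _ = _ := add_assoc _ _ _
        _ ≤ _ := add_le_add_right h2 _
  | zero => simp
  | add f f' _ _ h h' => rw [mul_add]; exact add_mem h h'
  | smul a f _ h => rw [mul_smul_comm]; exact Submodule.smul_mem _ _ h

lemma hasLead_zero_of_mem_repSpan (hm : IsWeylOrder m) {κ : ι → ℂ}
    (hg : ∀ i, HasLead m (g i) (lead i) (κ i)) {γ : Var n →₀ ℕ} {f : HWeyl n}
    (hf : f ∈ repSpan g lead {δ | δ ≺[m] γ}) : HasLead m f γ 0 := by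
  induction hf using Submodule.span_induction with
  | mem f hf =>
    obtain ⟨i, u, hu, rfl⟩ := hf
    by_cases h0 : normalForm n u = 0
    · have := normalForm_eq_zero h0
      rw [this, zero_mul]
      exact HasLead.zero m γ
    · exact ((HasLead.self m u).mul hm (hg i)).of_lt (hu _ (m.degree_mem_support h0))
  | zero => exact HasLead.zero m γ
  | add f f' _ _ h h' => simpa using h.add h'
  | smul a f _ h => simpa using h.smul a

/-- Finitely many exponents below `γ` have an upper bound below `γ`. -/
lemma exists_lt_of_mem_repSpan {γ : Var n →₀ ℕ} {f : HWeyl n}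
    (hf : f ∈ repSpan g lead {δ | δ ≺[m] γ}) (h0 : f ≠ 0) :
    ∃ γ', γ' ≺[m] γ ∧ f ∈ repSpan g lead {δ | δ ≼[m] γ'} := by
  suffices h : f = 0 ∨ ∃ γ', γ' ≺[m] γ ∧ f ∈ repSpan g lead {δ | δ ≼[m] γ'} from
    h.resolve_left h0
  clear h0
  induction hf using Submodule.span_induction with
  | mem f hf =>
    obtain ⟨i, u, hu, rfl⟩ := hf
    by_cases h0 : normalForm n u = 0
    · have := normalForm_eq_zero h0
      simp [this]
    · refine Or.inr ⟨_, hu _ (m.degree_mem_support h0),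
        mul_mem_repSpan_of_support fun α hα => ?_⟩
      rw [Set.mem_ofPred_eq, map_add, map_add]
      exact add_le_add_left (m.le_degree hα) _
  | zero => exact Or.inl rfl
  | add f f' _ _ h h' =>
    rcases h with rfl | ⟨δ, hδ, h⟩
    · simpa using h'
    rcases h' with rfl | ⟨δ', hδ', h'⟩
    · simpa using Or.inr ⟨δ, hδ, h⟩
    rcases le_total (m.toSyn δ) (m.toSyn δ') with hle | hle
    · exact Or.inr ⟨δ', hδ', add_mem (repSpan_mono (fun _ hε => le_trans hε hle) h) h'⟩
    · exact Or.inr ⟨δ, hδ, add_mem h (repSpan_mono (fun _ hε => le_trans hε hle) h')⟩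
  | smul a f _ h =>
    rcases h with rfl | ⟨δ, hδ, h⟩
    · simp
    · exact Or.inr ⟨δ, hδ, Submodule.smul_mem _ _ h⟩

lemma exists_mem_repSpan (hm : IsWeylOrder m) {f : HWeyl n}
    (hf : f ∈ Ideal.span (Set.range g)) :
    ∃ γ, f ∈ repSpan g lead {δ | δ ≼[m] γ} := by
  induction hf using Submodule.span_induction with
  | mem f hf =>
    obtain ⟨i, rfl⟩ := hf
    refine ⟨lead i, ?_⟩
    rw [← one_mul (g i)]
    refine mul_mem_repSpan_of_support fun α hα => ?_
    rw [Set.mem_ofPred_eq, map_add]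
    simpa using (m.le_degree hα).trans (HasLead.one m).1
  | zero => exact ⟨0, zero_mem _⟩
  | add f f' _ _ h h' =>
    obtain ⟨δ, h⟩ := h
    obtain ⟨δ', h'⟩ := h'
    rcases le_total (m.toSyn δ) (m.toSyn δ') with hle | hle
    · exact ⟨δ', add_mem (repSpan_mono (fun _ hε => le_trans hε hle) h) h'⟩
    · exact ⟨δ, add_mem h (repSpan_mono (fun _ hε => le_trans hε hle) h')⟩
  | smul a f _ h =>
    obtain ⟨δ, h⟩ := h
    exact ⟨_, mul_mem_repSpan_le hm (HasLead.self m a) h⟩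

/-- The S-pair of `g i` and `g j` has a standard representation: `s * g i` and `t * g j` have the
same leading exponent, the least common multiple of `lead i` and `lead j`, and their
difference is a combination of the `g k` with terms below this exponent. -/
def SPairReduces (m : MonomialOrder (Var n)) (g : ι → HWeyl n) (lead : ι → Var n →₀ ℕ)
    (i j : ι) : Prop :=
  ∃ (s t : HWeyl n) (σ τ : Var n →₀ ℕ) (c d : ℂ), HasLead m s σ c ∧ HasLead m t τ d ∧
    c ≠ 0 ∧ d ≠ 0 ∧ σ + lead i = τ + lead j ∧
    (∀ γ, lead i ≤ γ → lead j ≤ γ → σ + lead i ≤ γ) ∧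
    s * g i - t * g j ∈ repSpan g lead {δ | δ ≺[m] (σ + lead i)}

lemma SPairReduces.refl (m : MonomialOrder (Var n)) (i : ι) : SPairReduces m g lead i i :=
  ⟨1, 1, 0, 0, 1, 1, HasLead.one m, HasLead.one m, one_ne_zero, one_ne_zero, rfl,
    fun γ h _ => by rwa [zero_add], by simp⟩

lemma SPairReduces.symm {i j : ι} (h : SPairReduces m g lead i j) :
    SPairReduces m g lead j i := by
  obtain ⟨s, t, σ, τ, c, d, hs, ht, hc, hd, e, hle, hmem⟩ := h
  refine ⟨t, s, τ, σ, d, c, ht, hs, hd, hc, e.symm, fun γ h1 h2 => e ▸ hle γ h2 h1, ?_⟩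
  rw [← e, ← neg_sub]
  exact neg_mem hmem

/-- The product criterion: if the leading monomials are coprime, the S-pair is the commutator up
to smaller terms. -/
lemma SPairReduces.of_coprime {κ : ι → ℂ} (hκ : ∀ i, κ i ≠ 0)
    (hg : ∀ i, HasLead m (g i) (lead i) (κ i)) {i j : ι}
    (hcop : ∀ v, lead i v = 0 ∨ lead j v = 0)
    (hcomm : g j * g i - g i * g j ∈ repSpan g lead {δ | δ ≺[m] (lead j + lead i)}) :
    SPairReduces m g lead i j := by
  refine ⟨g j, g i, lead j, lead i, κ j, κ i, hg j, hg i, hκ j, hκ i, add_comm _ _,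
    fun γ h1 h2 v => ?_, hcomm⟩
  have h1 := h1 v
  have h2 := h2 v
  rw [Finsupp.add_apply]
  rcases hcop v with h | h <;> omega

/-- Modulo smaller representations, any two terms with the same leading exponent are
proportional. -/
lemma SPairReduces.exists_smul (hm : IsWeylOrder m) {i j : ι} (h : SPairReduces m g lead i j)
    {γ : Var n →₀ ℕ} (hi : lead i ≤ γ) (hj : lead j ≤ γ) :
    ∃ a : ℂ, normalMonomial (γ - lead i) * g i - a • (normalMonomial (γ - lead j) * g j) ∈
      repSpan g lead {δ | δ ≺[m] γ} := by
  obtain ⟨s, t, σ, τ, c, d, hs, ht, hc, hd, e, hle, hmem⟩ := h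
  set ω := γ - (σ + lead i) with hω
  have hωi : ω + (σ + lead i) = γ := tsub_add_cancel_of_le (hle γ hi hj)
  have hωj : ω + (τ + lead j) = γ := e ▸ hωi
  have h1 := mul_mem_repSpan_lt hm (HasLead.normalMonomial m ω) hmem
  rw [hωi] at h1
  have hsi : HasLead m (normalMonomial ω * s) (γ - lead i) c := by
    convert (HasLead.normalMonomial m ω).mul hm hs using 1
    · rw [← hωi, ← add_assoc, add_tsub_cancel_right]
    · simp
  have htj : HasLead m (normalMonomial ω * t) (γ - lead j) d := by
    convert (HasLead.normalMonomial m ω).mul hm ht using 1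
    · rw [← hωj, ← add_assoc, add_tsub_cancel_right]
    · simp
  have h2 : (normalMonomial ω * s - c • normalMonomial (γ - lead i)) * g i ∈
      repSpan g lead {δ | δ ≺[m] γ} :=
    mul_mem_repSpan_of_zero (by simpa using hsi.sub ((HasLead.normalMonomial m _).smul c))
      (tsub_add_cancel_of_le hi)
  have h3 : (normalMonomial ω * t - d • normalMonomial (γ - lead j)) * g j ∈
      repSpan g lead {δ | δ ≺[m] γ} :=
    mul_mem_repSpan_of_zero (by simpa using htj.sub ((HasLead.normalMonomial m _).smul d))
      (tsub_add_cancel_of_le hj)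
  refine ⟨c⁻¹ * d, ?_⟩
  have h4 := Submodule.smul_mem _ c⁻¹ (add_mem (sub_mem h1 h2) h3)
  convert h4 using 1
  rw [sub_mul, sub_mul, mul_sub, smul_mul_assoc, smul_mul_assoc, ← mul_assoc, ← mul_assoc]
  generalize normalMonomial ω * s * g i = A
  generalize normalMonomial ω * t * g j = B
  generalize normalMonomial (γ - lead j) * g j = D
  rw [show A - B - (A - c • (normalMonomial (γ - lead i) * g i)) + (B - d • D) =
    c • (normalMonomial (γ - lead i) * g i) - d • D by abel, smul_sub, inv_smul_smul₀ hc,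
    smul_smul]

/-- Terms of a representation up to `γ` reduce, modulo smaller ones, to a multiple of a single
term. -/
lemma repSpan_le_sup (hm : IsWeylOrder m) (hS : ∀ i j, SPairReduces m g lead i j)
    {γ : Var n →₀ ℕ} {i : ι} (hi : lead i ≤ γ) :
    repSpan g lead {δ | δ ≼[m] γ} ≤
      Submodule.span ℂ {normalMonomial (γ - lead i) * g i} ⊔
        repSpan g lead {δ | δ ≺[m] γ} := by
  refine Submodule.span_le.2 ?_
  rintro f ⟨j, u, hu, rfl⟩
  by_cases hj : lead j ≤ γ
  · set c := (normalForm n u).coeff (γ - lead j) with hc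
    have hu' : HasLead m u (γ - lead j) c := by
      refine HasLead.iff_forall.2 ⟨fun α hα => ?_, rfl⟩
      have h := hu α hα
      rw [Set.mem_ofPred_eq] at h
      nth_rewrite 1 [← tsub_add_cancel_of_le hj] at h
      rw [map_add, map_add] at h
      exact le_of_add_le_add_right h
    obtain ⟨a, ha⟩ := (hS j i).exists_smul hm hj hi
    have h2 : (u - c • normalMonomial (γ - lead j)) * g j ∈
        repSpan g lead {δ | δ ≺[m] γ} :=
      mul_mem_repSpan_of_zero (by simpa using hu'.sub ((HasLead.normalMonomial m _).smul c))
        (tsub_add_cancel_of_le hj)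
    refine Submodule.mem_sup.2 ⟨c • a • (normalMonomial (γ - lead i) * g i),
      Submodule.smul_mem _ _ (Submodule.smul_mem _ _ (Submodule.mem_span_singleton_self _)),
      _, add_mem (Submodule.smul_mem _ c ha) h2, ?_⟩
    rw [sub_mul, smul_mul_assoc, smul_sub]
    abel
  · refine Submodule.mem_sup_right (mul_mem_repSpan_of_support fun α hα => ?_)
    refine lt_of_le_of_ne (hu α hα) fun e => hj ?_
    rw [← m.toSyn.injective e]
    exact le_add_self

/-- Buchberger's criterion in the homogenized Weyl algebra: if all S-pairs have standard
representations, the initial monomial of every nonzero element of the left ideal is divisible by a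
leading monomial of a generator. -/
theorem exists_lead_le_degree (hm : IsWeylOrder m) {κ : ι → ℂ} (hκ : ∀ i, κ i ≠ 0)
    (hg : ∀ i, HasLead m (g i) (lead i) (κ i)) (hS : ∀ i j, SPairReduces m g lead i j)
    {f : HWeyl n} (hf : f ∈ Ideal.span (Set.range g)) (h0 : f ≠ 0) :
    ∃ i, lead i ≤ m.degree (normalForm n f) := by
  obtain ⟨γ₀, hγ₀⟩ := exists_mem_repSpan (m := m) (lead := lead) hm hf
  -- Among the representations of `f`, one whose largest exponent is minimal.
  obtain ⟨s, hs, hmin⟩ := (wellFounded_lt (α := m.syn)).has_min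
    {s | f ∈ repSpan g lead {δ | m.toSyn δ ≤ s}} ⟨_, hγ₀⟩
  obtain ⟨γ, rfl⟩ := m.toSyn.surjective s
  have hnot : f ∉ repSpan g lead {δ | δ ≺[m] γ} := by
    intro h
    obtain ⟨γ', hlt, h'⟩ := exists_lt_of_mem_repSpan h h0
    exact hmin _ h' hlt
  by_cases hex : ∃ i, lead i ≤ γ
  · obtain ⟨i, hi⟩ := hex
    obtain ⟨y, hy, z, hz, rfl⟩ := Submodule.mem_sup.1 (repSpan_le_sup hm hS hi hs)
    obtain ⟨a, rfl⟩ := Submodule.mem_span_singleton.1 hy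
    have ha : a ≠ 0 := by
      rintro rfl
      exact hnot (by simpa using hz)
    have hlead := (((HasLead.normalMonomial m (γ - lead i)).mul hm (hg i)).smul a)
    rw [tsub_add_cancel_of_le hi] at hlead
    have := (hlead.add (hasLead_zero_of_mem_repSpan hm hg hz)).degree_eq
      (by simpa using ⟨ha, hκ i⟩)
    exact ⟨i, hi.trans_eq this.symm⟩
  · refine absurd (Submodule.span_mono ?_ hs) hnot
    rintro _ ⟨i, u, hu, rfl⟩
    refine ⟨i, u, fun α hα => lt_of_le_of_ne (hu α hα) fun e => hex ⟨i, ?_⟩, rfl⟩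
    rw [← m.toSyn.injective e]
    exact le_add_self

/-- The criterion, in terms of initial ideals. -/
theorem isGroebnerBasis_of_sPairReduces [Finite ι] (hm : IsWeylOrder m) {κ : ι → ℂ}
    (hκ : ∀ i, κ i ≠ 0) (hg : ∀ i, HasLead m (g i) (lead i) (κ i))
    (hS : ∀ i j, SPairReduces m g lead i j) :
    IsGroebnerBasis m (Set.range g) (Ideal.span (Set.range g)) := by
  refine ⟨Set.finite_range g, rfl, le_antisymm
    (Ideal.span_mono (Set.image_mono Ideal.subset_span)) (Ideal.span_le.2 ?_)⟩
  rintro _ ⟨f, hf, rfl⟩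
  by_cases h0 : f = 0
  · rw [h0, initial, map_zero, m.leadingTerm_zero]
    exact zero_mem _
  obtain ⟨i, hi⟩ := exists_lead_le_degree hm hκ hg hS hf h0
  have e : initial m f = monomial (m.degree (normalForm n f) - lead i)
      (m.leadingCoeff (normalForm n f) * (κ i)⁻¹) * initial m (g i) := by
    have hc : m.leadingCoeff (normalForm n (g i)) = κ i := by
      rw [MonomialOrder.leadingCoeff, (hg i).degree_eq (hκ i), (hg i).2]
    rw [initial, initial, MonomialOrder.leadingTerm, MonomialOrder.leadingTerm, hc,
      (hg i).degree_eq (hκ i), monomial_mul, tsub_add_cancel_of_le hi,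
      inv_mul_cancel_right₀ (hκ i)]
  rw [SetLike.mem_coe, e]
  exact Ideal.mul_mem_left _ _ (Ideal.subset_span ⟨_, ⟨i, rfl⟩, rfl⟩)

end Criterion

/-! ### Commutators of the generators -/

/-! `lie_add` and its companions need a `LieRing` instance, which an associative ring does not carry
by default; the following are their versions for the bracket `Ring.instBracket`. -/

section Bracket

variable {R : Type*} [Ring R] (a b c : R)

lemma ring_lie_add : ⁅a, b + c⁆ = ⁅a, b⁆ + ⁅a, c⁆ := by
  simp only [Ring.lie_def]
  noncomm_ring

lemma ring_lie_sub : ⁅a, b - c⁆ = ⁅a, b⁆ - ⁅a, c⁆ := by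
  simp only [Ring.lie_def]
  noncomm_ring

lemma ring_add_lie : ⁅a + b, c⁆ = ⁅a, c⁆ + ⁅b, c⁆ := by
  simp only [Ring.lie_def]
  noncomm_ring

lemma ring_sub_lie : ⁅a - b, c⁆ = ⁅a, c⁆ - ⁅b, c⁆ := by
  simp only [Ring.lie_def]
  noncomm_ring

lemma ring_lie_mul : ⁅a, b * c⁆ = ⁅a, b⁆ * c + b * ⁅a, c⁆ := by
  simp only [Ring.lie_def]
  noncomm_ring

lemma ring_mul_lie : ⁅a * b, c⁆ = ⁅a, c⁆ * b + a * ⁅b, c⁆ := by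
  simp only [Ring.lie_def]
  noncomm_ring

lemma ring_lie_sum {ι : Type*} (s : Finset ι) (f : ι → R) :
    ⁅a, ∑ i ∈ s, f i⁆ = ∑ i ∈ s, ⁅a, f i⁆ := by
  simp only [Ring.lie_def, Finset.mul_sum, Finset.sum_mul, Finset.sum_sub_distrib]

lemma ring_sum_lie {ι : Type*} (s : Finset ι) (f : ι → R) :
    ⁅∑ i ∈ s, f i, a⁆ = ∑ i ∈ s, ⁅f i, a⁆ := by
  simp only [Ring.lie_def, Finset.mul_sum, Finset.sum_mul, Finset.sum_sub_distrib]

lemma ring_lie_natCast (k : ℕ) : ⁅a, (k : R)⁆ = 0 := by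
  rw [Ring.lie_def, (Nat.cast_commute k _).eq, sub_self]

lemma ring_lie_skew : ⁅b, a⁆ = -⁅a, b⁆ := by
  simp only [Ring.lie_def, neg_sub]

end Bracket

/-- Elements of a ring that satisfy the defining relations of the homogenized Weyl algebra. The
identities between the generators use nothing else and are proved in this generality. -/
structure IsWeylSystem {R : Type*} [Ring R] (e : Var n → R) : Prop where
  comm (u v : Var n) (huv : ¬ u.base = some v) (hvu : ¬ v.base = some u) : ⁅e u, e v⁆ = 0
  weyl (u v : Var n) (huv : u.base = some v) : ⁅e u, e v⁆ = e .h ^ 2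

lemma isWeylSystem_gen : IsWeylSystem (gen : Var n → HWeyl n) where
  comm _ _ huv hvu := by rw [Ring.lie_def, gen_comm huv hvu, sub_self]
  weyl _ _ huv := by rw [Ring.lie_def, gen_weyl huv, add_sub_cancel_left]

section Commutators

variable {R : Type*} [Ring R] (e : Var n → R)

/-- The operator `φ_i = x_{ii} ∂_i + ∑_s x_{is} ∂_s + h y_i + b_i c_i`, the sum of
`h y_i + b_i c_i` and of the derivative of the quadratic form `∑_{i ≤ j} x_{ij} ∂_i ∂_j` with
respect to `∂_i`. -/
def phi (i : Fin (n + 1)) : R :=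
  e (.x s(i, i)) * e (.dy i) + ∑ s, e (.x s(i, s)) * e (.dy s) + e .h * e (.y i) +
    e (.b i) * e (.c i)

/-- The operator `h ∂_{pq} - ∂_p ∂_q`. -/
def theta (p q : Fin (n + 1)) : R := e .h * e (.dx s(p, q)) - e (.dy p) * e (.dy q)

variable {e}

namespace IsWeylSystem

variable (he : IsWeylSystem e)

include he

lemma commute {u v : Var n} (huv : u.base ≠ some v) (hvu : v.base ≠ some u) :
    Commute (e u) (e v) :=
  sub_eq_zero.1 ((Ring.lie_def _ _).symm.trans (he.comm _ _ huv hvu))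

lemma lie_dx_x (p q : Sym2 (Fin (n + 1))) :
    ⁅e (.dx p), e (.x q)⁆ = if p = q then e .h ^ 2 else 0 := by
  split_ifs with h
  · exact he.weyl _ _ (by simp [Var.base, h])
  · exact he.comm _ _ (by simpa [Var.base] using h) (by simp [Var.base])

lemma lie_dy_y (i j : Fin (n + 1)) :
    ⁅e (.dy i), e (.y j)⁆ = if i = j then e .h ^ 2 else 0 := by
  split_ifs with h
  · exact he.weyl _ _ (by simp [Var.base, h])
  · exact he.comm _ _ (by simpa [Var.base] using h) (by simp [Var.base])

lemma lie_dy_phi (i j : Fin (n + 1)) :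
    ⁅e (.dy i), phi e j⁆ = if i = j then e .h ^ 3 else 0 := by
  simp only [phi, ring_lie_add, ring_lie_sum, ring_lie_mul, he.lie_dy_y]
  simp [he.comm, Var.base, pow_succ']

lemma lie_x_phi (p : Sym2 (Fin (n + 1))) (j : Fin (n + 1)) : ⁅e (.x p), phi e j⁆ = 0 := by
  simp [phi, ring_lie_add, ring_lie_sum, ring_lie_mul, he.comm, Var.base]

lemma lie_x_dx (p q : Sym2 (Fin (n + 1))) :
    ⁅e (.x p), e (.dx q)⁆ = if q = p then -e .h ^ 2 else 0 := by
  rw [ring_lie_skew, he.lie_dx_x]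
  split_ifs <;> simp

lemma lie_y_dy (i j : Fin (n + 1)) :
    ⁅e (.y i), e (.dy j)⁆ = if j = i then -e .h ^ 2 else 0 := by
  rw [ring_lie_skew, he.lie_dy_y]
  split_ifs <;> simp

/-- The `h y_i` in one factor meet the `∂_i` in the other, and the contributions cancel because
`x_{ij} = x_{ji}`. -/
lemma lie_phi_phi (i j : Fin (n + 1)) : ⁅phi e i, phi e j⁆ = 0 := by
  have hx (p : Sym2 (Fin (n + 1))) : e .h * e (.x p) = e (.x p) * e .h :=
    he.commute (by simp [Var.base]) (by simp [Var.base])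
  simp [phi, ring_lie_add, ring_add_lie, ring_lie_sum, ring_sum_lie, ring_lie_mul, ring_mul_lie,
    he.comm, Var.base, he.lie_dy_y, he.lie_y_dy]
  rw [Sym2.eq_swap (a := j) (b := i)]
  split_ifs with h1 h2 h2
  · subst h1
    simp [mul_add, ← mul_assoc, hx]
  · exact absurd h1.symm h2
  · exact absurd h2.symm h1
  · simp [← mul_assoc, hx]

/-- The commutators of `h ∂_{pq}` with the `x_{js}` in `φ_j` cancel those of `∂_p ∂_q` with
`h y_j`. -/
lemma lie_theta_phi (p q j : Fin (n + 1)) : ⁅theta e p q, phi e j⁆ = 0 := by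
  have hy (i : Fin (n + 1)) : e .h * e (.dy i) = e (.dy i) * e .h :=
    he.commute (by simp [Var.base]) (by simp [Var.base])
  have hy' (i : Fin (n + 1)) (z : R) : e .h * (e (.dy i) * z) = e (.dy i) * (e .h * z) := by
    rw [← mul_assoc, hy, mul_assoc]
  simp [theta, phi, ring_lie_add, ring_sub_lie, ring_lie_sum, ring_lie_mul, ring_mul_lie,
    he.comm, Var.base, he.lie_dy_y, he.lie_dx_x]
  by_cases hp : p = j <;> by_cases hq : q = j <;>
    simp [hp, hq, pow_two, mul_assoc, hy, hy', mul_add]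

lemma lie_phi_dy (i j : Fin (n + 1)) : ⁅phi e i, e (.dy j)⁆ = if j = i then -e .h ^ 3 else 0 := by
  rw [ring_lie_skew, he.lie_dy_phi]
  split_ifs <;> simp

lemma lie_a_phi (p : Sym2 (Fin (n + 1))) (j : Fin (n + 1)) : ⁅e (.a p), phi e j⁆ = 0 := by
  simp [phi, ring_lie_add, ring_lie_sum, ring_lie_mul, he.comm, Var.base]

lemma lie_phi_d (j : Fin (n + 1)) : ⁅phi e j, e .d⁆ = 0 := by
  simp [phi, ring_add_lie, ring_sum_lie, ring_mul_lie, he.comm, Var.base]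

lemma lie_phi_h (j : Fin (n + 1)) : ⁅phi e j, e .h⁆ = 0 := by
  simp [phi, ring_add_lie, ring_sum_lie, ring_mul_lie, he.comm, Var.base]

lemma lie_phi_r (j : Fin (n + 1)) : ⁅phi e j, e .r⁆ = 0 := by
  simp [phi, ring_add_lie, ring_sum_lie, ring_mul_lie, he.comm, Var.base]

lemma lie_phi_dr (j : Fin (n + 1)) : ⁅phi e j, e .dr⁆ = 0 := by
  simp [phi, ring_add_lie, ring_sum_lie, ring_mul_lie, he.comm, Var.base]

end IsWeylSystem

variable (e)

/-- The generator `A'^h_{pq}`, written in terms of `h ∂_{pq} - ∂_p ∂_q`. -/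
def sysA (p q : Fin (n + 1)) : R := e (.x s(p, q)) * theta e p q - e (.a s(p, q)) ^ 3

/-- The generator `B`. -/
def sysB : R := ∑ i, e (.dy i) ^ 2 - e .r ^ 2

/-- The generator `C'^h_{ij}`, as a minor of the matrix with rows `∂_i` and `φ_i`. -/
def sysC (i j : Fin (n + 1)) : R := phi e j * e (.dy i) - phi e i * e (.dy j)

/-- The generator `E'^h`, with its Euler operator `∑_i φ_i ∂_i`. -/
def sysE : R :=
  e .h * e .r * e .dr - ∑ i, phi e i * e (.dy i) - (n : R) * e .h ^ 3 - e .d ^ 3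

variable {e}

namespace IsWeylSystem

variable (he : IsWeylSystem e)

include he

lemma sysA_eq (p q : Fin (n + 1)) : sysA e p q =
    e .h * e (.x s(p, q)) * e (.dx s(p, q)) - e (.x s(p, q)) * e (.dy p) * e (.dy q) -
      e (.a s(p, q)) ^ 3 := by
  have hx : e .h * e (.x s(p, q)) = e (.x s(p, q)) * e .h :=
    he.commute (by simp [Var.base]) (by simp [Var.base])
  rw [sysA, theta, hx]
  noncomm_ring

lemma phi_mul_dy (i j : Fin (n + 1)) : phi e j * e (.dy i) =
    e (.x s(j, j)) * e (.dy i) * e (.dy j) + ∑ s, e (.x s(s, j)) * e (.dy i) * e (.dy s) +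
      (e .h * e (.y j) + e (.b j) * e (.c j)) * e (.dy i) := by
  have hd (s : Fin (n + 1)) : e (.dy i) * e (.dy s) = e (.dy s) * e (.dy i) :=
    he.commute (by simp [Var.base]) (by simp [Var.base])
  simp only [phi, mul_assoc, hd, add_mul, Finset.sum_mul, Sym2.eq_swap (a := j), add_assoc]

lemma sysC_eq {i j : Fin (n + 1)} (hij : i ≠ j) : sysC e i j =
    e (.x s(i, j)) * e (.dy i) ^ 2 + 2 * (e (.x s(j, j)) - e (.x s(i, i))) * e (.dy i) * e (.dy j)
      - e (.x s(i, j)) * e (.dy j) ^ 2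
      + ∑ s with s ≠ i ∧ s ≠ j, (e (.x s(s, j)) * e (.dy i) * e (.dy s)
        - e (.x s(i, s)) * e (.dy j) * e (.dy s))
      + (e .h * e (.y j) + e (.b j) * e (.c j)) * e (.dy i)
      - (e .h * e (.y i) + e (.b i) * e (.c i)) * e (.dy j) := by
  have hd : e (.dy j) * e (.dy i) = e (.dy i) * e (.dy j) :=
    he.commute (by simp [Var.base]) (by simp [Var.base])
  have hsum (f : Fin (n + 1) → R) : ∑ s, f s = f i + (f j + ∑ s with s ≠ i ∧ s ≠ j, f s) := by
    have h1 : (Finset.univ.filter fun s => s ≠ i ∧ s ≠ j) =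
        (Finset.univ.erase i).erase j := by
      ext s
      simp [and_comm]
    rw [h1, Finset.add_sum_erase _ _ (by simpa using hij.symm), Finset.add_sum_erase _ _ (by simp)]
  rw [sysC, he.phi_mul_dy, he.phi_mul_dy, hsum fun s => _, hsum fun s => _,
    Finset.sum_sub_distrib]
  simp only [Sym2.eq_swap (a := i)]
  rw [mul_assoc _ (e (.dy j)) (e (.dy i)), hd]
  noncomm_ring

lemma sysE_eq : sysE e =
    e .h * e .r * e .dr
      - 2 * ∑ i : Fin (n + 1), ∑ j with i ≤ j, e (.x s(i, j)) * e (.dy i) * e (.dy j)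
      - ∑ i, (e .h * e (.y i) + e (.b i) * e (.c i)) * e (.dy i) - (n : R) * e .h ^ 3
      - e .d ^ 3 := by
  have hsymm : ∀ F : Fin (n + 1) → Fin (n + 1) → R, (∀ i j, F i j = F j i) →
      2 * ∑ i, ∑ j with i ≤ j, F i j = ∑ i, F i i + ∑ i, ∑ j, F i j := by
    intro F hF
    have h1 : ∑ i, ∑ j, F i j = ∑ i, ∑ j with i ≤ j, F i j + ∑ i, ∑ j with j < i, F i j := by
      rw [← Finset.sum_add_distrib]
      refine Finset.sum_congr rfl fun i _ => ?_
      rw [← Finset.sum_filter_add_sum_filter_not _ (fun j => i ≤ j)]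
      simp
    have h2 : ∑ i, ∑ j with j < i, F i j = ∑ i, ∑ j with i < j, F i j := by
      simp only [Finset.sum_filter]
      rw [Finset.sum_comm]
      simp only [hF]
    have h3 : ∑ i, ∑ j with i ≤ j, F i j = ∑ i, F i i + ∑ i, ∑ j with i < j, F i j := by
      rw [← Finset.sum_add_distrib]
      refine Finset.sum_congr rfl fun i _ => ?_
      have : (Finset.univ.filter fun j => i ≤ j) =
          insert i (Finset.univ.filter fun j => i < j) := by
        ext j
        simp [le_iff_eq_or_lt, eq_comm]
      rw [this, Finset.sum_insert (by simp)]
    rw [two_mul, h1, h2]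
    nth_rewrite 1 [h3]
    abel
  have hd (i j : Fin (n + 1)) : e (.dy i) * e (.dy j) = e (.dy j) * e (.dy i) :=
    he.commute (by simp [Var.base]) (by simp [Var.base])
  rw [hsymm _ fun i j => by rw [Sym2.eq_swap, mul_assoc, hd, mul_assoc], sysE]
  simp only [he.phi_mul_dy, Finset.sum_add_distrib]
  simp only [Sym2.eq_swap]
  abel

lemma lie_sysA_dy (p q i : Fin (n + 1)) : ⁅sysA e p q, e (.dy i)⁆ = 0 := by
  simp [sysA, theta, ring_sub_lie, ring_mul_lie, pow_three, he.comm, Var.base]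

lemma lie_sysA_phi (p q i : Fin (n + 1)) : ⁅sysA e p q, phi e i⁆ = 0 := by
  simp [sysA, ring_sub_lie, ring_mul_lie, pow_three, he.lie_a_phi, he.lie_x_phi, he.lie_theta_phi]

lemma lie_sysA_sysA {p q p' q' : Fin (n + 1)} (h : s(p, q) ≠ s(p', q')) :
    ⁅sysA e p q, sysA e p' q'⁆ = 0 := by
  have h1 : ⁅e (.x s(p, q)), e (.dx s(p', q'))⁆ = 0 := by rw [he.lie_x_dx, if_neg h.symm]
  have h2 : ⁅e (.dx s(p, q)), e (.x s(p', q'))⁆ = 0 := by rw [he.lie_dx_x, if_neg h]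
  simp [sysA, theta, ring_sub_lie, ring_lie_sub, ring_mul_lie, ring_lie_mul, pow_three, h1, h2,
    he.comm, Var.base]

lemma lie_sysA_sysB (p q : Fin (n + 1)) : ⁅sysA e p q, sysB e⁆ = 0 := by
  have h : ⁅sysA e p q, e .r⁆ = 0 := by
    simp [sysA, theta, ring_sub_lie, ring_mul_lie, pow_three, he.comm, Var.base]
  simp [sysB, ring_lie_sub, ring_lie_sum, pow_two, ring_lie_mul, he.lie_sysA_dy, h]

lemma lie_sysA_sysC (p q i j : Fin (n + 1)) : ⁅sysA e p q, sysC e i j⁆ = 0 := by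
  simp [sysC, ring_lie_sub, ring_lie_mul, he.lie_sysA_dy, he.lie_sysA_phi]

lemma lie_sysA_sysE (p q : Fin (n + 1)) : ⁅sysA e p q, sysE e⁆ = 0 := by
  have hr : ⁅sysA e p q, e .r⁆ = 0 := by
    simp [sysA, theta, ring_sub_lie, ring_mul_lie, pow_three, he.comm, Var.base]
  have hdr : ⁅sysA e p q, e .dr⁆ = 0 := by
    simp [sysA, theta, ring_sub_lie, ring_mul_lie, pow_three, he.comm, Var.base]
  have hh : ⁅sysA e p q, e .h⁆ = 0 := by
    simp [sysA, theta, ring_sub_lie, ring_mul_lie, pow_three, he.comm, Var.base]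
  have hd : ⁅sysA e p q, e .d⁆ = 0 := by
    simp [sysA, theta, ring_sub_lie, ring_mul_lie, pow_three, he.comm, Var.base]
  simp [sysE, ring_lie_sub, ring_lie_sum, ring_lie_mul, pow_three, he.lie_sysA_dy,
    he.lie_sysA_phi, hr, hdr, hh, hd, ring_lie_natCast]

lemma lie_sysB_phi (j : Fin (n + 1)) : ⁅sysB e, phi e j⁆ = 2 * e .h ^ 3 * e (.dy j) := by
  have hd : e (.dy j) * e .h = e .h * e (.dy j) :=
    he.commute (by simp [Var.base]) (by simp [Var.base])
  have hd' (z : R) : e (.dy j) * (e .h * z) = e .h * (e (.dy j) * z) := by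
    rw [← mul_assoc, hd, mul_assoc]
  have hr : ⁅e .r, phi e j⁆ = 0 := by rw [ring_lie_skew, he.lie_phi_r, neg_zero]
  simp [sysB, ring_sub_lie, ring_sum_lie, pow_two, ring_mul_lie, he.lie_dy_phi, hr,
    Finset.sum_add_distrib]
  simp only [pow_three, mul_assoc, hd', hd, two_mul, add_mul]

lemma lie_sysB_dy (j : Fin (n + 1)) : ⁅sysB e, e (.dy j)⁆ = 0 := by
  simp [sysB, ring_sub_lie, ring_sum_lie, pow_two, ring_mul_lie, he.comm, Var.base]

lemma lie_sysB_sysC (i j : Fin (n + 1)) : ⁅sysB e, sysC e i j⁆ = 0 := by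
  have hd : e (.dy j) * e (.dy i) = e (.dy i) * e (.dy j) :=
    he.commute (by simp [Var.base]) (by simp [Var.base])
  simp [sysC, ring_lie_sub, ring_lie_mul, he.lie_sysB_dy, he.lie_sysB_phi, mul_assoc, hd]

lemma lie_sysB_sysE : ⁅sysB e, sysE e⁆ = -(e .h ^ 3 * sysB e + e .h ^ 3 * sysB e) := by
  have hhr : e .r * e .h = e .h * e .r :=
    he.commute (by simp [Var.base]) (by simp [Var.base])
  have hhr' (z : R) : e .r * (e .h * z) = e .h * (e .r * z) := by
    rw [← mul_assoc, hhr, mul_assoc]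
  have hr : ⁅sysB e, e .r⁆ = 0 := by
    simp [sysB, ring_sub_lie, ring_sum_lie, pow_two, ring_mul_lie, he.comm, Var.base]
  have hh : ⁅sysB e, e .h⁆ = 0 := by
    simp [sysB, ring_sub_lie, ring_sum_lie, pow_two, ring_mul_lie, he.comm, Var.base]
  have hd : ⁅sysB e, e .d⁆ = 0 := by
    simp [sysB, ring_sub_lie, ring_sum_lie, pow_two, ring_mul_lie, he.comm, Var.base]
  have hrdr : ⁅e .r, e .dr⁆ = -e .h ^ 2 := by rw [ring_lie_skew, he.weyl .dr .r rfl]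
  have hdr : ⁅sysB e, e .dr⁆ = 2 * e .h ^ 2 * e .r := by
    simp [sysB, ring_sub_lie, ring_sum_lie, pow_two, ring_mul_lie, he.comm, Var.base]
    simp only [hrdr, pow_two, neg_mul, mul_neg, mul_assoc, hhr, hhr', two_mul, add_mul]
    abel
  have h1 : ⁅sysB e, sysE e⁆ =
      e .h * e .r * (2 * e .h ^ 2 * e .r) - ∑ i, 2 * e .h ^ 3 * e (.dy i) * e (.dy i) := by
    simp [sysE, ring_lie_sub, ring_lie_sum, ring_lie_mul, pow_three, hr, hdr, hh, hd,
      ring_lie_natCast, he.lie_sysB_dy, he.lie_sysB_phi]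
  have h2 : e .h * e .r * (2 * e .h ^ 2 * e .r) = 2 * e .h ^ 3 * e .r ^ 2 := by
    simp only [pow_two, pow_three, two_mul, mul_assoc, add_mul, mul_add, hhr']
  rw [h1, h2, ← two_mul, sysB, mul_sub, Finset.mul_sum, mul_sub, Finset.mul_sum]
  simp only [pow_two (e (.dy _)), mul_assoc]
  abel

lemma lie_dy_sysE (i : Fin (n + 1)) : ⁅e (.dy i), sysE e⁆ = -e .h ^ 3 * e (.dy i) := by
  simp [sysE, ring_lie_sub, ring_lie_sum, ring_lie_mul, pow_three, ring_lie_natCast,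
    he.lie_dy_phi, he.comm, Var.base]

lemma lie_phi_sysE (j : Fin (n + 1)) : ⁅phi e j, sysE e⁆ = phi e j * e .h ^ 3 := by
  simp [sysE, ring_lie_sub, ring_lie_sum, ring_lie_mul, pow_three, ring_lie_natCast,
    he.lie_phi_dy, he.lie_phi_phi, he.lie_phi_h, he.lie_phi_d, he.lie_phi_r, he.lie_phi_dr]

lemma lie_sysC_sysE (i j : Fin (n + 1)) : ⁅sysC e i j, sysE e⁆ = 0 := by
  simp only [sysC, ring_sub_lie, ring_mul_lie, he.lie_dy_sysE, he.lie_phi_sysE]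
  noncomm_ring

/-- The minors satisfy the commutation relations of the orthogonal Lie algebra. -/
lemma lie_sysC_sysC {i j l : Fin (n + 1)} (hij : i ≠ j) (hjl : j ≠ l) (hil : i ≠ l) :
    ⁅sysC e i j, sysC e j l⁆ = -e .h ^ 3 * sysC e i l := by
  have hh (i : Fin (n + 1)) : phi e i * e .h = e .h * phi e i :=
    sub_eq_zero.1 ((Ring.lie_def _ _).symm.trans (he.lie_phi_h i))
  have hh' (i : Fin (n + 1)) (z : R) : phi e i * (e .h * z) = e .h * (phi e i * z) := by
    rw [← mul_assoc, hh, mul_assoc]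
  simp [sysC, ring_lie_sub, ring_sub_lie, ring_lie_mul, ring_mul_lie, he.lie_phi_phi,
    he.lie_phi_dy, he.lie_dy_phi, he.comm, Var.base, hij, hjl, hil, hij.symm, hil.symm,
    hjl.symm]
  simp only [pow_three, mul_assoc, hh, hh', mul_sub]
  abel

lemma lie_sysC_sysC_of_ne {i j k l : Fin (n + 1)} (hik : i ≠ k) (hil : i ≠ l) (hjk : j ≠ k)
    (hjl : j ≠ l) : ⁅sysC e i j, sysC e k l⁆ = 0 := by
  simp [sysC, ring_lie_sub, ring_sub_lie, ring_lie_mul, ring_mul_lie, he.lie_phi_phi,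
    he.lie_phi_dy, he.lie_dy_phi, he.comm, Var.base, hik, hil, hjk, hjl, hik.symm, hil.symm,
    hjk.symm, hjl.symm]

/-- The Laplace expansion of the vanishing determinant with rows `∂`, `∂`, `φ`. -/
lemma dy_mul_sysC {i j l : Fin (n + 1)} (hij : i ≠ j) (hjl : j ≠ l) (hil : i ≠ l) :
    e (.dy l) * sysC e i j - e (.dy j) * sysC e i l = -(e (.dy i) * sysC e j l) := by
  have h {i j : Fin (n + 1)} (hij : i ≠ j) : e (.dy i) * phi e j = phi e j * e (.dy i) :=
    sub_eq_zero.1 ((Ring.lie_def _ _).symm.trans (by rw [he.lie_dy_phi, if_neg hij]))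
  have hd (i j : Fin (n + 1)) : e (.dy i) * e (.dy j) = e (.dy j) * e (.dy i) :=
    he.commute (by simp [Var.base]) (by simp [Var.base])
  simp only [sysC, mul_sub, ← mul_assoc, h hij, h hjl, h hil, h hij.symm, h hjl.symm, h hil.symm]
  simp only [mul_assoc, hd l i, hd l j, hd j i]
  abel

/-- The Laplace expansion of the vanishing determinant with rows `φ`, `φ`, `∂`. -/
lemma phi_mul_sysC (i j k : Fin (n + 1)) :
    phi e k * sysC e i j - phi e i * sysC e k j = phi e j * sysC e i k := by
  have h (i j : Fin (n + 1)) : phi e i * phi e j = phi e j * phi e i :=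
    sub_eq_zero.1 ((Ring.lie_def _ _).symm.trans (he.lie_phi_phi i j))
  simp only [sysC, mul_sub, ← mul_assoc]
  rw [h k j, h k i, h i j]
  abel

end IsWeylSystem

end Commutators

/-! ### Comparison of monomials in the term order -/

section TermOrder

lemma exps_apply {ι : Type} [Finite ι] (v : ι → Var n) (α : Var n →₀ ℕ) (i : ι) :
    exps v α i = α (v i) := rfl

lemma expo_apply (v : Var n) (α : Var n →₀ ℕ) : expo v α = α v := rfl

lemma exps_single_eq_zero {ι : Type} [Finite ι] {v : ι → Var n} {w : Var n}
    (h : ∀ i, w ≠ v i) (k : ℕ) : exps v (Finsupp.single w k) = 0 := by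
  ext i
  simp [exps_apply, h]

lemma exps_b_single (i : Fin (n + 1)) :
    exps .b (Finsupp.single (Var.b i) 1) = Finsupp.single i 1 := by
  ext j
  by_cases h : i = j
  · simp [exps_apply, h]
  · simp [exps_apply, Finsupp.single_eq_of_ne' h, h]

variable (T : TieBreaker n) {α β : Var n →₀ ℕ}

/-- For monomials of equal degree, the block of `d` decides as soon as the weights agree; a
smaller weight only helps. The lemmas for the further blocks are similar. -/
lemma lt_of_d (hdeg : α.degree = β.degree)
    (hw : Finsupp.weight Var.weight α ≤ Finsupp.weight Var.weight β) (hd : α .d < β .d) :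
    α ≺[termOrder T] β := by
  rw [termOrder_lt_iff]
  simp only [key, Prod.Lex.toLex_lt_toLex, expo_apply]
  exact .inr ⟨hdeg, hw.lt_or_eq.imp_right fun hw => ⟨hw, .inl hd⟩⟩

lemma lt_of_r (hdeg : α.degree = β.degree)
    (hw : Finsupp.weight Var.weight α ≤ Finsupp.weight Var.weight β) (hd : α .d = β .d)
    (hr : α .r < β .r) : α ≺[termOrder T] β := by
  rw [termOrder_lt_iff]
  simp only [key, Prod.Lex.toLex_lt_toLex, expo_apply]
  exact .inr ⟨hdeg, hw.lt_or_eq.imp_right fun hw => ⟨hw, .inr ⟨hd, .inl hr⟩⟩⟩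

lemma lt_of_a (hdeg : α.degree = β.degree)
    (hw : Finsupp.weight Var.weight α ≤ Finsupp.weight Var.weight β) (hd : α .d = β .d)
    (hr : α .r = β .r) (ha : exps .a α = 0) (ha' : exps .a β ≠ 0) : α ≺[termOrder T] β := by
  rw [termOrder_lt_iff]
  simp only [key, Prod.Lex.toLex_lt_toLex, expo_apply]
  refine .inr ⟨hdeg, hw.lt_or_eq.imp_right fun hw => ⟨hw, .inr ⟨hd, .inr ⟨hr, .inl ?_⟩⟩⟩⟩
  rw [ha, map_zero]
  exact T.a.toSyn_lt_iff_ne_zero.2 (by simpa using ha')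

lemma lt_of_b (hdeg : α.degree = β.degree)
    (hw : Finsupp.weight Var.weight α ≤ Finsupp.weight Var.weight β) (hd : α .d = β .d)
    (hr : α .r = β .r) (ha : exps .a α = exps .a β)
    (hb : exps .b α ≺[MonomialOrder.lex] exps .b β) : α ≺[termOrder T] β := by
  rw [termOrder_lt_iff]
  simp only [key, Prod.Lex.toLex_lt_toLex, expo_apply]
  exact .inr ⟨hdeg, hw.lt_or_eq.imp_right fun hw =>
    ⟨hw, .inr ⟨hd, .inr ⟨hr, .inr ⟨congrArg _ ha, .inl hb⟩⟩⟩⟩⟩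

/-- The monomials `h ^ 2` and `∂ v` have the same degree and the same weight, and `h` is in the
last block, so that the first block in which `∂ v` is nontrivial decides. -/
lemma isWeylOrder_termOrder : IsWeylOrder (termOrder T) := by
  intro u v huv
  cases u with
  | dx p =>
    obtain rfl : Var.x p = v := by simpa [Var.base] using huv
    rw [termOrder_lt_iff]
    simp only [key, Prod.Lex.toLex_lt_toLex, expo_apply]
    refine .inr ⟨by simp, .inr ⟨by simp [Finsupp.weight_single, Var.weight]; split_ifs <;> simp,
      .inr ⟨by simp, .inr ⟨by simp, .inr ⟨by simp [exps_single_eq_zero],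
      .inr ⟨by simp [exps_single_eq_zero], .inr ⟨by simp [exps_single_eq_zero],
      .inr ⟨by simp [exps_single_eq_zero], .inr ⟨by simp, ?_⟩⟩⟩⟩⟩⟩⟩⟩⟩
    by_cases hp : p.IsDiag
    · refine .inr ⟨?_, .inl ?_⟩
      · rw [map_add, exps_single_eq_zero (by simp), exps_single_eq_zero, exps_single_eq_zero,
          add_zero]
        · simp
        · rintro q h
          exact q.2 (Var.dx.inj h ▸ hp)
      · rw [exps_single_eq_zero (by simp), map_zero, T.dxDiag.toSyn_lt_iff_ne_zero]
        obtain ⟨i, rfl⟩ : ∃ i, s(i, i) = p := ⟨p.diagElem hp, Sym2.diag_diagElem hp⟩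
        intro h
        simpa [exps_apply] using DFunLike.congr_fun ((T.dxDiag.toSyn_eq_zero_iff _).1 h) i
    · left
      rw [exps_single_eq_zero (by simp), map_zero, T.dxOff.toSyn_lt_iff_ne_zero]
      intro h
      simpa [exps_apply] using DFunLike.congr_fun ((T.dxOff.toSyn_eq_zero_iff _).1 h) ⟨p, hp⟩
  | dy i =>
    obtain rfl : Var.y i = v := by simpa [Var.base] using huv
    rw [termOrder_lt_iff]
    simp only [key, Prod.Lex.toLex_lt_toLex, expo_apply]
    refine .inr ⟨by simp, .inr ⟨by simp [Finsupp.weight_single, Var.weight],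
      .inr ⟨by simp, .inr ⟨by simp, .inr ⟨by simp [exps_single_eq_zero],
      .inr ⟨by simp [exps_single_eq_zero], .inr ⟨by simp [exps_single_eq_zero],
      .inl ?_⟩⟩⟩⟩⟩⟩⟩
    rw [exps_single_eq_zero (by simp), map_zero, T.y.toSyn_lt_iff_ne_zero]
    intro h
    simpa [exps_apply] using DFunLike.congr_fun ((T.y.toSyn_eq_zero_iff _).1 h) i
  | dr =>
    obtain rfl : Var.r = v := by simpa [Var.base] using huv
    exact lt_of_r T (by simp) (by simp [Finsupp.weight_single, Var.weight]) (by simp) (by simp)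
  | _ => simp [Var.base] at huv

lemma lex_single_lt {i j : Fin (n + 1)} (hij : i < j) :
    Finsupp.single j 1 ≺[MonomialOrder.lex] Finsupp.single i 1 := by
  rw [MonomialOrder.lex_lt_iff]
  exact Finsupp.Lex.single_lt_iff.2 hij

lemma lex_single_pos (j : Fin (n + 1)) :
    0 < MonomialOrder.lex.toSyn (Finsupp.single j 1) := by
  rw [MonomialOrder.toSyn_lt_iff_ne_zero, Ne, MonomialOrder.toSyn_eq_zero_iff]
  simp

/-- The weight of `x_p` is `0` or `-1`, so that the block of the `b_i` decides only if `p` is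
diagonal. -/
lemma x_dy_lt_b_c (p : Sym2 (Fin (n + 1))) (s j : Fin (n + 1)) :
    (Finsupp.single (.x p) 1 + Finsupp.single (.dy s) 1) ≺[termOrder T]
      (Finsupp.single (.b j) 1 + Finsupp.single (.c j) 1) := by
  refine lt_of_b T (by simp) ?_ (by simp) (by simp) (by simp [exps_single_eq_zero]) ?_
  · simp [Finsupp.weight_single, Var.weight]
    split_ifs <;> simp
  · simpa [exps_single_eq_zero, exps_b_single] using lex_single_pos j

lemma h_y_lt_b_c (i j : Fin (n + 1)) :
    (Finsupp.single .h 1 + Finsupp.single (.y i) 1) ≺[termOrder T]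
      (Finsupp.single (.b j) 1 + Finsupp.single (.c j) 1) := by
  refine lt_of_b T (by simp) ?_ (by simp) (by simp) (by simp [exps_single_eq_zero]) ?_
  · simp [Finsupp.weight_single, Var.weight]
  · simpa [exps_single_eq_zero, exps_b_single] using lex_single_pos j

lemma b_c_dy_lt {i j : Fin (n + 1)} (hij : i < j) (k l : Fin (n + 1)) :
    (Finsupp.single (.b j) 1 + Finsupp.single (.c j) 1 + Finsupp.single (.dy k) 1) ≺[termOrder T]
      (Finsupp.single (.b i) 1 + Finsupp.single (.c i) 1 + Finsupp.single (.dy l) 1) := by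
  refine lt_of_b T (by simp) ?_ (by simp) (by simp) (by simp [exps_single_eq_zero]) ?_
  · simp [Finsupp.weight_single, Var.weight]
  · simpa [exps_single_eq_zero, exps_b_single] using lex_single_lt hij

lemma h_lt_b_c_dy (j l : Fin (n + 1)) :
    Finsupp.single .h 3 ≺[termOrder T]
      (Finsupp.single (.b j) 1 + Finsupp.single (.c j) 1 + Finsupp.single (.dy l) 1) := by
  refine lt_of_b T (by simp) ?_ (by simp) (by simp) (by simp [exps_single_eq_zero]) ?_
  · simp [Finsupp.weight_single, Var.weight]
  · simpa [exps_single_eq_zero, exps_b_single] using lex_single_pos j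

lemma b_c_dy_lt_d (i : Fin (n + 1)) :
    (Finsupp.single (.b i) 1 + Finsupp.single (.c i) 1 + Finsupp.single (.dy i) 1) ≺[termOrder T]
      Finsupp.single .d 3 :=
  lt_of_d T (by simp) (by simp [Finsupp.weight_single, Var.weight]) (by simp)

lemma h_r_dr_lt_d : (Finsupp.single .h 1 + Finsupp.single .r 1 + Finsupp.single .dr 1)
    ≺[termOrder T] Finsupp.single .d 3 :=
  lt_of_d T (by simp) (by simp [Finsupp.weight_single, Var.weight]) (by simp)

lemma h_lt_d : Finsupp.single .h 3 ≺[termOrder T] Finsupp.single .d 3 :=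
  lt_of_d T (by simp) (by simp [Finsupp.weight_single, Var.weight]) (by simp)

lemma dy_lt_r (i : Fin (n + 1)) :
    Finsupp.single (.dy i) 2 ≺[termOrder T] Finsupp.single .r 2 :=
  lt_of_r T (by simp) (by simp [Finsupp.weight_single, Var.weight]) (by simp) (by simp)

lemma x_h_dx_lt_a (p : Sym2 (Fin (n + 1))) :
    (Finsupp.single (.x p) 1 + (Finsupp.single .h 1 + Finsupp.single (.dx p) 1)) ≺[termOrder T]
      Finsupp.single (.a p) 3 := by
  refine lt_of_a T (by simp) ?_ (by simp) (by simp) (by simp [exps_single_eq_zero]) fun h => ?_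
  · simp [Finsupp.weight_single, Var.weight]
    split_ifs <;> simp
  · simpa [exps_apply] using DFunLike.congr_fun h p

lemma x_dy_dy_lt_a (p : Sym2 (Fin (n + 1))) (i j : Fin (n + 1)) :
    (Finsupp.single (.x p) 1 + (Finsupp.single (.dy i) 1 + Finsupp.single (.dy j) 1))
      ≺[termOrder T] Finsupp.single (.a p) 3 := by
  refine lt_of_a T (by simp) ?_ (by simp) (by simp) (by simp [exps_single_eq_zero]) fun h => ?_
  · simp [Finsupp.weight_single, Var.weight]
    split_ifs <;> simp
  · simpa [exps_apply] using DFunLike.congr_fun h p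

end TermOrder

/-! ### The S-pairs of the generators -/

section Generators

lemma genA_eq (p q : Fin (n + 1)) : genA p q = sysA gen p q :=
  (isWeylSystem_gen.sysA_eq p q).symm

lemma genC_eq {i j : Fin (n + 1)} (hij : i ≠ j) : genC i j = sysC gen i j :=
  (isWeylSystem_gen.sysC_eq hij).symm

lemma genE_eq : genE n = sysE gen :=
  isWeylSystem_gen.sysE_eq.symm

/-- The indices of the generators `A_{pq}` (`p ≤ q`), `B`, `C_{ij}` (`i < j`) and `E`. -/
inductive GenIdx (n : ℕ) : Type
  | A (p q : Fin (n + 1)) (h : p ≤ q)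
  | B
  | C (i j : Fin (n + 1)) (h : i < j)
  | E

instance : Finite (GenIdx n) := by
  refine Finite.of_injective
    (β := (Fin (n + 1) × Fin (n + 1)) ⊕ (Fin (n + 1) × Fin (n + 1)) ⊕ Bool)
    (fun t => match t with
      | .A p q _ => .inl (p, q)
      | .C i j _ => .inr (.inl (i, j))
      | .B => .inr (.inr true)
      | .E => .inr (.inr false)) ?_
  intro s t h
  cases s <;> cases t <;> simp_all

/-- The generators. -/
noncomputable def GenIdx.elem : GenIdx n → HWeyl n
  | A p q _ => sysA gen p q
  | B => sysB gen
  | C i j _ => sysC gen i j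
  | E => sysE gen

/-- The exponents of the initial monomials `a_{pq} ^ 3`, `r ^ 2`, `b_i c_i ∂_j`, `d ^ 3` of the
generators. -/
noncomputable def GenIdx.lead : GenIdx n → Var n →₀ ℕ
  | A p q _ => Finsupp.single (.a s(p, q)) 3
  | B => Finsupp.single .r 2
  | C i j _ => Finsupp.single (.b i) 1 + Finsupp.single (.c i) 1 + Finsupp.single (.dy j) 1
  | E => Finsupp.single .d 3

lemma range_elem : Set.range (GenIdx.elem : GenIdx n → HWeyl n) = homogGens n := by
  ext f
  constructor
  · rintro ⟨_ | _ | _ | _, rfl⟩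
    case A p q h => exact .inl (.inl (.inl ⟨p, q, h, (genA_eq p q).symm⟩))
    case B => exact .inl (.inl (.inr rfl))
    case C i j h => exact .inl (.inr ⟨i, j, h, (genC_eq h.ne).symm⟩)
    case E => exact .inr genE_eq.symm
  · rintro (((⟨p, q, h, rfl⟩ | rfl) | ⟨i, j, h, rfl⟩) | rfl)
    · exact ⟨.A p q h, (genA_eq p q).symm⟩
    · exact ⟨.B, rfl⟩
    · exact ⟨.C i j h, (genC_eq h.ne).symm⟩
    · exact ⟨.E, genE_eq.symm⟩

variable (T : TieBreaker n)

lemma hasLead_gen (v : Var n) : HasLead (termOrder T) (gen v) (Finsupp.single v 1) 1 :=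
  HasLead.gen (isWeylOrder_termOrder T) v

lemma hasLead_gen_pow (v : Var n) (k : ℕ) :
    HasLead (termOrder T) (gen v ^ k) (Finsupp.single v k) 1 := by
  simpa using (hasLead_gen T v).pow (isWeylOrder_termOrder T) k

lemma hasLead_phi (j : Fin (n + 1)) : HasLead (termOrder T) (phi gen j)
    (Finsupp.single (.b j) 1 + Finsupp.single (.c j) 1) 1 := by
  have hm := isWeylOrder_termOrder T
  have hxd (p : Sym2 (Fin (n + 1))) (s : Fin (n + 1)) : HasLead (termOrder T)
      (gen (.x p) * gen (.dy s)) (Finsupp.single (.b j) 1 + Finsupp.single (.c j) 1) 0 :=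
    ((hasLead_gen T _).mul hm (hasLead_gen T _)).of_lt (x_dy_lt_b_c T p s j)
  have hy : HasLead (termOrder T) (gen .h * gen (.y j))
      (Finsupp.single (.b j) 1 + Finsupp.single (.c j) 1) 0 :=
    ((hasLead_gen T _).mul hm (hasLead_gen T _)).of_lt (h_y_lt_b_c T j j)
  exact ((((hxd s(j, j) j).add (HasLead.sum Finset.univ fun s _ => hxd s(j, s) s)).add hy).add
    ((hasLead_gen T (.b j)).mul hm (hasLead_gen T (.c j)))).congr rfl (by norm_num)

lemma hasLead_elem (t : GenIdx n) : HasLead (termOrder T) t.elem t.lead (-1) := by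
  have hm := isWeylOrder_termOrder T
  cases t with
  | A p q h =>
    have h1 := ((hasLead_gen T .h).mul hm (hasLead_gen T (.dx s(p, q))))
    have h2 := ((hasLead_gen T (.dy p)).mul hm (hasLead_gen T (.dy q)))
    have h3 := (((hasLead_gen T (.x s(p, q))).mul hm h1).of_lt (x_h_dx_lt_a T _)).sub
      (((hasLead_gen T (.x s(p, q))).mul hm h2).of_lt (x_dy_dy_lt_a T _ _ _))
    exact (h3.sub (hasLead_gen_pow T (.a s(p, q)) 3)).congr
      (congrArg (· - _) (mul_sub _ _ _).symm) (by norm_num)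
  | B =>
    exact ((HasLead.sum Finset.univ fun i _ =>
      (hasLead_gen_pow T (.dy i) 2).of_lt (dy_lt_r T i)).sub (hasLead_gen_pow T .r 2)).congr
      rfl (by norm_num)
  | C i j h =>
    exact ((((hasLead_phi T j).mul hm (hasLead_gen T (.dy i))).of_lt (b_c_dy_lt T h i j)).sub
      ((hasLead_phi T i).mul hm (hasLead_gen T (.dy j)))).congr rfl (by norm_num)
  | E =>
    have h1 := (((hasLead_gen T .h).mul hm (hasLead_gen T .r)).mul hm
      (hasLead_gen T .dr)).of_lt (h_r_dr_lt_d T)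
    have h2 := HasLead.sum Finset.univ fun i _ =>
      ((hasLead_phi T i).mul hm (hasLead_gen T (.dy i))).of_lt (b_c_dy_lt_d T i)
    have h3 := ((hasLead_gen_pow T .h 3).smul (n : ℂ)).of_lt (h_lt_d T)
    have hn : (n : ℂ) • gen .h ^ 3 = (n : HWeyl n) * gen .h ^ 3 := by
      rw [Algebra.smul_def, map_natCast]
    rw [hn] at h3
    exact (((h1.sub h2).sub h3).sub (hasLead_gen_pow T .d 3)).congr rfl (by norm_num)

/-- The S-pair of two generators with coprime initial monomials that commute. -/
lemma sPairReduces_of_commute {s t : GenIdx n} (hcop : ∀ v, s.lead v = 0 ∨ t.lead v = 0)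
    (h : ⁅t.elem, s.elem⁆ = 0) :
    SPairReduces (termOrder T) GenIdx.elem GenIdx.lead s t := by
  refine SPairReduces.of_coprime (κ := fun _ => -1) (by simp) (hasLead_elem T) hcop ?_
  rw [← Ring.lie_def, h]
  exact zero_mem _

lemma single_coprime {u v : Var n} (h : u ≠ v) (k l : ℕ) (w : Var n) :
    Finsupp.single u k w = 0 ∨ Finsupp.single v l w = 0 := by
  by_cases hu : u = w
  · exact .inr (Finsupp.single_eq_of_ne' (hu ▸ h.symm))
  · exact .inl (Finsupp.single_eq_of_ne' hu)

lemma coprime_lead_C_C {i j k l : Fin (n + 1)} (hij : i < j) (hkl : k < l) (hik : i ≠ k)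
    (hjl : j ≠ l) (v : Var n) : (GenIdx.C i j hij).lead v = 0 ∨ (GenIdx.C k l hkl).lead v = 0 := by
  have hb := single_coprime (u := .b i) (v := .b k) (by simpa) 1 1 v
  have hc := single_coprime (u := .c i) (v := .c k) (by simpa) 1 1 v
  have hd := single_coprime (u := .dy j) (v := .dy l) (by simpa) 1 1 v
  cases v with
  | b => simpa [GenIdx.lead] using hb
  | c => simpa [GenIdx.lead] using hc
  | dy => simpa [GenIdx.lead] using hd
  | _ => simp [GenIdx.lead]

/-- The least common multiple of `X ^ (α + β)` and `X ^ (α + β')` for coprime `X ^ β` and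
`X ^ β'`. -/
lemma add_add_le_of_coprime {α β β' γ : Var n →₀ ℕ} (hcop : ∀ v, β v = 0 ∨ β' v = 0)
    (h : α + β ≤ γ) (h' : α + β' ≤ γ) : β' + (α + β) ≤ γ := by
  intro v
  have h := h v
  have h' := h' v
  simp only [Finsupp.add_apply] at h h' ⊢
  rcases hcop v with h0 | h0 <;> omega

/-- Two minors with the same first index: a Laplace expansion. -/
lemma sPairReduces_C_left {i j l : Fin (n + 1)} (hij : i < j) (hil : i < l) (hjl : j < l) :
    SPairReduces (termOrder T) GenIdx.elem GenIdx.lead (.C i j hij) (.C i l hil) := by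
  refine ⟨gen (.dy l), gen (.dy j), Finsupp.single (.dy l) 1, Finsupp.single (.dy j) 1, 1, 1,
    hasLead_gen T _, hasLead_gen T _, one_ne_zero, one_ne_zero, ?_, ?_, ?_⟩
  · simp only [GenIdx.lead]
    abel
  · exact fun γ => add_add_le_of_coprime (single_coprime (by simpa using hjl.ne) 1 1)
  · rw [show gen (.dy l) * (GenIdx.C i j hij).elem - gen (.dy j) * (GenIdx.C i l hil).elem =
      -(gen (.dy i) * (GenIdx.C j l hjl).elem) from
      isWeylSystem_gen.dy_mul_sysC hij.ne hjl.ne hil.ne]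
    refine neg_mem (mul_mem_repSpan_of_lt (hasLead_gen T _) ?_)
    convert add_lt_add_left (b_c_dy_lt T hij i j)
      ((termOrder T).toSyn (Finsupp.single (.dy l) 1)) using 1
    · rw [← map_add, GenIdx.lead]
      congr 1
      abel
    · rw [← map_add, GenIdx.lead, add_comm]

/-- Two minors with the same second index: a Laplace expansion. -/
lemma sPairReduces_C_right {i k j : Fin (n + 1)} (hij : i < j) (hkj : k < j) (hik : i < k) :
    SPairReduces (termOrder T) GenIdx.elem GenIdx.lead (.C i j hij) (.C k j hkj) := by
  refine ⟨phi gen k, phi gen i, _, _, 1, 1,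
    hasLead_phi T k, hasLead_phi T i, one_ne_zero, one_ne_zero, ?_, ?_, ?_⟩
  · simp only [GenIdx.lead]
    abel
  · intro γ h h'
    simp only [GenIdx.lead, add_comm _ (Finsupp.single (Var.dy j) 1)] at h h' ⊢
    refine add_add_le_of_coprime (fun v => ?_) h h'
    have hb := single_coprime (u := .b i) (v := .b k) (by simpa using hik.ne) 1 1 v
    have hc := single_coprime (u := .c i) (v := .c k) (by simpa using hik.ne) 1 1 v
    cases v with
    | b => simpa using hb
    | c => simpa using hc
    | _ => simp
  · rw [show phi gen k * (GenIdx.C i j hij).elem - phi gen i * (GenIdx.C k j hkj).elem =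
      phi gen j * (GenIdx.C i k hik).elem from isWeylSystem_gen.phi_mul_sysC i j k]
    refine mul_mem_repSpan_of_lt (hasLead_phi T j) ?_
    convert add_lt_add_left (b_c_dy_lt T hkj k j)
      ((termOrder T).toSyn (Finsupp.single (.b i) 1 + Finsupp.single (.c i) 1)) using 1
    · rw [← map_add, GenIdx.lead]
      congr 1
      abel
    · rw [← map_add, GenIdx.lead]
      congr 1
      abel

/-- Two minors with `j` as second and as first index: their commutator is a multiple of a
minor. -/
lemma sPairReduces_C_chain {i j l : Fin (n + 1)} (hij : i < j) (hjl : j < l) :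
    SPairReduces (termOrder T) GenIdx.elem GenIdx.lead (.C i j hij) (.C j l hjl) := by
  refine SPairReduces.symm (SPairReduces.of_coprime (κ := fun _ => -1) (by simp) (hasLead_elem T)
    (coprime_lead_C_C hjl hij hij.ne' hjl.ne') ?_)
  rw [← Ring.lie_def, show ⁅(GenIdx.C i j hij).elem, (GenIdx.C j l hjl).elem⁆ =
    -gen .h ^ 3 * (GenIdx.C i l (hij.trans hjl)).elem from
    isWeylSystem_gen.lie_sysC_sysC hij.ne hjl.ne (hij.trans hjl).ne]
  refine mul_mem_repSpan_of_lt (hasLead_gen_pow T .h 3).neg ?_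
  convert add_lt_add_left (h_lt_b_c_dy T j j) ((termOrder T).toSyn
    (Finsupp.single (.b i) 1 + Finsupp.single (.c i) 1 + Finsupp.single (.dy l) 1)) using 1
  · rw [← map_add, GenIdx.lead]
  · rw [← map_add, GenIdx.lead, GenIdx.lead]
    congr 1
    abel

/-- The commutator of `B` and `E` is `-2 h ^ 3 B`. -/
lemma sPairReduces_E_B :
    SPairReduces (termOrder T) GenIdx.elem GenIdx.lead (.E : GenIdx n) .B := by
  refine SPairReduces.of_coprime (κ := fun _ => -1) (by simp) (hasLead_elem T)
    (single_coprime (by simp) 3 2) ?_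
  rw [← Ring.lie_def, show ⁅GenIdx.B.elem, GenIdx.E.elem⁆ =
    -(gen .h ^ 3 * GenIdx.B.elem (n := n) + gen .h ^ 3 * GenIdx.B.elem) from
    isWeylSystem_gen.lie_sysB_sysE]
  have h : gen .h ^ 3 * GenIdx.B.elem (n := n) ∈ repSpan GenIdx.elem GenIdx.lead
      {δ | δ ≺[termOrder T] (GenIdx.lead (n := n) .B + GenIdx.lead .E)} := by
    refine mul_mem_repSpan_of_lt (hasLead_gen_pow T .h 3) ?_
    rw [add_comm (GenIdx.lead .B), map_add, map_add]
    exact add_lt_add_left (h_lt_d T) _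
  exact neg_mem (add_mem h h)

lemma sPairReduces_C_C {i j k l : Fin (n + 1)} (hij : i < j) (hkl : k < l) :
    SPairReduces (termOrder T) GenIdx.elem GenIdx.lead (.C i j hij) (.C k l hkl) := by
  by_cases hik : i = k
  · subst hik
    rcases lt_trichotomy j l with hjl | rfl | hjl
    · exact sPairReduces_C_left T hij hkl hjl
    · exact SPairReduces.refl _ _
    · exact (sPairReduces_C_left T hkl hij hjl).symm
  by_cases hjl : j = l
  · subst hjl
    rcases lt_or_gt_of_ne hik with hik | hik
    · exact sPairReduces_C_right T hij hkl hik
    · exact (sPairReduces_C_right T hkl hij hik).symm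
  by_cases hjk : j = k
  · subst hjk
    exact sPairReduces_C_chain T hij hkl
  by_cases hil : i = l
  · subst hil
    exact (sPairReduces_C_chain T hkl hij).symm
  · exact sPairReduces_of_commute T (coprime_lead_C_C hij hkl hik hjl)
      (isWeylSystem_gen.lie_sysC_sysC_of_ne (Ne.symm hik) (Ne.symm hjk) (Ne.symm hil)
        (Ne.symm hjl))

lemma sPairReduces_A {p q : Fin (n + 1)} (hpq : p ≤ q) (t : GenIdx n) :
    SPairReduces (termOrder T) GenIdx.elem GenIdx.lead t (.A p q hpq) := by
  cases t with
  | A p' q' h =>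
    by_cases he : s(p, q) = s(p', q')
    · obtain ⟨rfl, rfl⟩ : p = p' ∧ q = q' := by
        rcases Sym2.eq_iff.1 he with h' | ⟨rfl, rfl⟩
        · exact h'
        · exact ⟨le_antisymm hpq h, le_antisymm h hpq⟩
      exact SPairReduces.refl _ _
    · exact sPairReduces_of_commute T (single_coprime (by simpa using Ne.symm he) 3 3)
        (isWeylSystem_gen.lie_sysA_sysA he)
  | B =>
    exact sPairReduces_of_commute T (single_coprime (by simp) 2 3)
      (isWeylSystem_gen.lie_sysA_sysB p q)
  | C i j h =>
    refine sPairReduces_of_commute T (fun v => ?_) (isWeylSystem_gen.lie_sysA_sysC p q i j)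
    cases v <;> simp [GenIdx.lead]
  | E =>
    exact sPairReduces_of_commute T (single_coprime (by simp) 3 3)
      (isWeylSystem_gen.lie_sysA_sysE p q)

lemma sPairReduces_elem (s t : GenIdx n) :
    SPairReduces (termOrder T) GenIdx.elem GenIdx.lead s t := by
  have hCB {i j : Fin (n + 1)} (h : i < j) :
      SPairReduces (termOrder T) GenIdx.elem GenIdx.lead (.C i j h) .B := by
    refine sPairReduces_of_commute T (fun v => ?_) (isWeylSystem_gen.lie_sysB_sysC i j)
    cases v <;> simp [GenIdx.lead]
  have hEC {i j : Fin (n + 1)} (h : i < j) :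
      SPairReduces (termOrder T) GenIdx.elem GenIdx.lead .E (.C i j h) := by
    refine sPairReduces_of_commute T (fun v => ?_) (isWeylSystem_gen.lie_sysC_sysE i j)
    cases v <;> simp [GenIdx.lead]
  cases s with
  | A p q h => exact (sPairReduces_A T h t).symm
  | B =>
    cases t with
    | A p q h => exact sPairReduces_A T h _
    | B => exact SPairReduces.refl _ _
    | C i j h => exact (hCB h).symm
    | E => exact (sPairReduces_E_B T).symm
  | C i j h =>
    cases t with
    | A p q h => exact sPairReduces_A T h _
    | B => exact hCB h
    | C k l h' => exact sPairReduces_C_C T h h'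
    | E => exact (hEC h).symm
  | E =>
    cases t with
    | A p q h => exact sPairReduces_A T h _
    | B => exact sPairReduces_E_B T
    | C i j h => exact hEC h
    | E => exact SPairReduces.refl _ _

end Generators

end FisherBingham

theorem proposition5 (n : ℕ) (T : FisherBingham.TieBreaker n) :
    FisherBingham.IsGroebnerBasis (FisherBingham.termOrder T) (FisherBingham.homogGens n)
      (FisherBingham.homogIdeal n) := by
  rw [FisherBingham.homogIdeal, ← FisherBingham.range_elem]
  exact FisherBingham.isGroebnerBasis_of_sPairReduces (κ := fun _ => -1)
    (FisherBingham.isWeylOrder_termOrder T) (by simp) (FisherBingham.hasLead_elem T)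
    (FisherBingham.sPairReduces_elem T)
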